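/- Let $k\ge 1$ be an integer, let $\alpha=(\alpha_1,\dots,\alpha_k)\in(0,1]^k$ with $|\alpha|=\sum_i\alpha_i=1$, and let $P=(p_{ij})_{i,j\in[k]}$ be a symmetric real matrix with all entries $p_{ij}\in(0,1)$; all of these are fixed, independent of $n$. For $n\in\mathbb N$ let $G(n,\alpha,P)$ be the random graph whose vertex set is a disjoint union $V_1\cup\dots\cup V_k$ of $n$ vertices in total with $|V_i|=\lfloor\alpha_i n\rfloor$ for $i\le k-1$, and in which any two distinct vertices $u\in V_i$, $v\in V_j$ are joined by an edge with probability $p_{ij}$, independently for all pairs. For $c\in\mathbb R^k$ and $I\subseteq[k]$ put \[ g(c,I)=\sum_{i\in I}c_i+\frac12\sum_{i,j\in I}c_ic_j\ln(1-p_{ij}), \] let \[ \mathcal A=\{c\in\mathbb R_{\ge0}^k : g(c,I)\ge 0\text{ for all }\varnothing\ne I\subseteq[k]\}, \] and write $|c|=\sum_i|c_i|$ for the 1-norm. Then the maximum \[ c^\star=\max\{|c| : c\in\mathrm{conv}(\mathcal A)\cap\{t\alpha : t\in\mathbb R_{\ge 0}\}\} \] exists and is positive, and the chromatic number of $G\sim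 G(n,\alpha,P)$ satisfies, with high probability as $n\to\infty$, \[ \chi(G)=(1+o(1))\,\frac{n}{c^\star\ln n}, \] that is, for every $\varepsilon>0$, \[ \Pr\Big[\,\Big|\chi(G)-\frac{n}{c^\star\ln n}\Big|\le\varepsilon\,\frac{n}{c^\star\ln n}\Big]\to 1\quad\text{as } n\to\infty . \] -/

import Mathlib

open MeasureTheory Filter Topology

noncomputable section

namespace RandomBlockGraph

/-- The 1-norm of a vector in `ℝ^k`. -/
def oneNorm {k : ℕ} (c : Fin k → ℝ) : ℝ := ∑ i, |c i|

/-- The number of vertices of the `i`-th part: `⌊α_i n⌋` for every part but the last one, and the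
last part takes the vertices that remain of the `n`. -/
def blockSize {k : ℕ} (α : Fin k → ℝ) (n : ℕ) (i : Fin k) : ℕ :=
  if (i : ℕ) + 1 = k then n - ∑ j ∈ Finset.univ.filter (fun j : Fin k => (j : ℕ) + 1 < k), ⌊α j * n⌋₊ else ⌊α i * n⌋₊

/-- The vertex set `V = V_1 ∪ ⋯ ∪ V_k`; the vertex `⟨i, x⟩` belongs to the part `V_i`. -/
abbrev Vertex {k : ℕ} (α : Fin k → ℝ) (n : ℕ) : Type :=
  (i : Fin k) × Fin (blockSize α n i)

/-- The probability `p_ij` of the edge `uv`, where `u ∈ V_i` and `v ∈ V_j`. -/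
def edgeProb {k : ℕ} (α : Fin k → ℝ) (P : Matrix (Fin k) (Fin k) ℝ) (hP : P.IsSymm) (n : ℕ) :
    Sym2 (Vertex α n) → ℝ :=
  Sym2.lift ⟨fun u v => P u.1 v.1, fun u v => hP.apply v.1 u.1⟩

/-- The law of the random block graph `G(n, α, P)`: independent Bernoulli variables, one for each
unordered pair of vertices, decide which pairs are edges. (The projection onto `[0, 1]` does not
change the entries of `P`, which lie there; `SimpleGraph.fromEdgeSet` ignores the pairs `uu`.) -/
def law {k : ℕ} (α : Fin k → ℝ) (P : Matrix (Fin k) (Fin k) ℝ) (hP : P.IsSymm) (n : ℕ) :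
    Measure (SimpleGraph (Vertex α n)) :=
  (Measure.pi fun e : Sym2 (Vertex α n) =>
      ProbabilityTheory.bernoulliMeasure true false
        (Set.projIcc (0 : ℝ) 1 zero_le_one (edgeProb α P hP n e))).map
    fun ω => SimpleGraph.fromEdgeSet {e | ω e = true}

/-- `g(c, I) = ∑_{i ∈ I} c_i + ½ ∑_{i, j ∈ I} c_i c_j ln (1 - p_ij)`. -/
def g {k : ℕ} (P : Matrix (Fin k) (Fin k) ℝ) (c : Fin k → ℝ) (I : Finset (Fin k)) : ℝ :=
  ∑ i ∈ I, c i + 1 / 2 * ∑ i ∈ I, ∑ j ∈ I, c i * c j * Real.log (1 - P i j)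

/-- The set `𝒜` of admissible types. -/
def admissible {k : ℕ} (P : Matrix (Fin k) (Fin k) ℝ) : Set (Fin k → ℝ) :=
  {c | (∀ i, 0 ≤ c i) ∧ ∀ I : Finset (Fin k), I.Nonempty → 0 ≤ g P c I}

/-- The 1-norms of the vectors in `conv(𝒜)` on the ray `{t α : t ≥ 0}`. -/
def rayNorms {k : ℕ} (α : Fin k → ℝ) (P : Matrix (Fin k) (Fin k) ℝ) : Set ℝ :=
  oneNorm '' (convexHull ℝ (admissible P) ∩ {c | ∃ t : ℝ, 0 ≤ t ∧ c = t • α})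

/-- The constant `c⋆`, as a supremum; that it is attained is part of the theorem. -/
def cStar {k : ℕ} (α : Fin k → ℝ) (P : Matrix (Fin k) (Fin k) ℝ) : ℝ := sSup (rayNorms α P)

/-- The chromatic number of a graph on finitely many vertices, as a real number. -/
def chi {V : Type} [Finite V] (G : SimpleGraph V) : ℝ := (G.chromaticNumber.toNat : ℝ)

end RandomBlockGraph

end

/-- In finite dimension, the convex hull of a compact set is compact. -/
theorem IsCompact.convexHull_of_finiteDimensional {E : Type*} [AddCommGroup E] [Module ℝ E]
    [TopologicalSpace E] [ContinuousAdd E] [ContinuousSMul ℝ E] [FiniteDimensional ℝ E]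
    {s : Set E} (hs : IsCompact s) : IsCompact (convexHull ℝ s) := by
  rcases s.eq_empty_or_nonempty with rfl | ⟨a, ha⟩
  · simp
  set d := Module.finrank ℝ E + 1 with hd
  have key : convexHull ℝ s = (fun p : (Fin d → ℝ) × (Fin d → E) => ∑ i, p.1 i • p.2 i) ''
      (stdSimplex ℝ (Fin d) ×ˢ Set.univ.pi fun _ => s) := by
    apply Set.Subset.antisymm
    · intro x hx
      obtain ⟨ι, _, z, w, hz, hind, hw, hw1, hx⟩ := eq_pos_convex_span_of_mem_convexHull hx
      have hcard : Fintype.card ι ≤ Fintype.card (Fin d) := by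
        have h := hind.card_le_finrank_succ
        have h2 := Submodule.finrank_le (vectorSpan ℝ (Set.range z))
        simp only [Fintype.card_fin]
        omega
      obtain ⟨e⟩ := Function.Embedding.nonempty_of_card_le hcard
      have hout : ∀ j, j ∉ Set.range e → Function.extend e w 0 j = 0 := fun j hj =>
        Function.extend_apply' _ _ _ hj
      refine ⟨(Function.extend e w 0, Function.extend e z fun _ => a), ⟨⟨fun j => ?_, ?_⟩, ?_⟩, ?_⟩
      · by_cases hj : j ∈ Set.range e
        · obtain ⟨i, rfl⟩ := hj
          simpa only [e.injective.extend_apply] using (hw i).le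
        · exact (hout j hj).ge
      · rw [← hw1]
        symm
        apply Finset.sum_of_injOn e e.injective.injOn (by simp)
          fun j _ hj => hout j (by simpa using hj)
        intro i _
        rw [e.injective.extend_apply]
      · intro j _
        by_cases hj : j ∈ Set.range e
        · obtain ⟨i, rfl⟩ := hj
          simpa only [e.injective.extend_apply] using hz ⟨i, rfl⟩
        · simpa only [Function.extend_apply' _ _ _ hj] using ha
      · rw [← hx]
        symm
        apply Finset.sum_of_injOn e e.injective.injOn (by simp)
        · intro j _ hj
          simp only [hout j (by simpa using hj), zero_smul]
        · intro i _
          simp only [e.injective.extend_apply]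
    · rintro _ ⟨⟨w, z⟩, ⟨hw, hz⟩, rfl⟩
      exact (convex_convexHull ℝ s).sum_mem (fun i _ => hw.1 i) hw.2
        fun i _ => subset_convexHull ℝ s (hz i trivial)
  rw [key]
  refine ((isCompact_stdSimplex ℝ (Fin d)).prod (isCompact_univ_pi fun _ => hs)).image ?_
  fun_prop

namespace RandomBlockGraph

variable {k : ℕ} {P : Matrix (Fin k) (Fin k) ℝ} {α : Fin k → ℝ}

theorem g_empty (c : Fin k → ℝ) : g P c ∅ = 0 := by simp [g]

theorem g_nonneg_of_mem {c : Fin k → ℝ} (hc : c ∈ admissible P) (I : Finset (Fin k)) :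
    0 ≤ g P c I := by
  rcases I.eq_empty_or_nonempty with rfl | hI
  · exact (g_empty c).ge
  · exact hc.2 I hI

theorem g_congr {c d : Fin k → ℝ} {I : Finset (Fin k)} (h : ∀ i ∈ I, c i = d i) :
    g P c I = g P d I := by
  unfold g
  rw [Finset.sum_congr rfl h]
  congr 2
  refine Finset.sum_congr rfl fun i hi => Finset.sum_congr rfl fun j hj => ?_
  rw [h i hi, h j hj]

theorem g_insert (c : Fin k → ℝ) {i : Fin k} {I : Finset (Fin k)} (hi : i ∉ I) :
    g P c (insert i I) = c i + 1 / 2 * c i ^ 2 * Real.log (1 - P i i)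
      + c i * (1 / 2 * ∑ j ∈ I, c j * (Real.log (1 - P i j) + Real.log (1 - P j i)))
      + g P c I := by
  unfold g
  simp only [Finset.sum_insert hi, Finset.sum_add_distrib, mul_add, Finset.mul_sum]
  have h1 : ∀ j, 1 / 2 * (c i * c j * Real.log (1 - P i j))
      = c i * (1 / 2 * (c j * Real.log (1 - P i j))) := fun j => by ring
  have h2 : ∀ j, 1 / 2 * (c j * c i * Real.log (1 - P j i))
      = c i * (1 / 2 * (c j * Real.log (1 - P j i))) := fun j => by ring
  simp only [h1, h2]
  ring

theorem log_one_sub_neg (hP01 : ∀ i j, P i j ∈ Set.Ioo (0 : ℝ) 1) (i j : Fin k) :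
    Real.log (1 - P i j) < 0 :=
  Real.log_neg (by linarith [(hP01 i j).2]) (by linarith [(hP01 i j).1])

theorem update_mem_admissible (hP01 : ∀ i j, P i j ∈ Set.Ioo (0 : ℝ) 1) {c : Fin k → ℝ}
    (hc : c ∈ admissible P) {i : Fin k} {v : ℝ} (hv : 0 ≤ v) (hvc : v ≤ c i) :
    Function.update c i v ∈ admissible P := by
  refine ⟨fun j => ?_, fun I _ => ?_⟩
  · rcases eq_or_ne j i with rfl | h
    · simpa
    · simpa [h] using hc.1 j
  by_cases hi : i ∈ I
  · have hni : i ∉ I.erase i := Finset.notMem_erase i I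
    have hne : ∀ j ∈ I.erase i, Function.update c i v j = c j := fun j hj =>
      Function.update_of_ne (Finset.ne_of_mem_erase hj) _ _
    have h1 := g_nonneg_of_mem hc I
    have h0 := g_nonneg_of_mem hc (I.erase i)
    rw [← Finset.insert_erase hi, g_insert _ hni] at h1 ⊢
    rw [g_congr hne, Finset.sum_congr rfl fun j hj => by rw [hne j hj], Function.update_self]
    set B := 1 / 2 * ∑ j ∈ I.erase i, c j * (Real.log (1 - P i j) + Real.log (1 - P j i))
    set G := g P c (I.erase i)
    have hl := log_one_sub_neg hP01 i i
    set l := Real.log (1 - P i i)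
    rcases (hc.1 i).eq_or_lt with h | h
    · have : v = 0 := le_antisymm (h ▸ hvc) hv
      subst this
      simpa using h0
    · obtain ⟨t, ht0, ht1, rfl⟩ : ∃ t, 0 ≤ t ∧ t ≤ 1 ∧ v = t * c i :=
        ⟨v / c i, by positivity, (div_le_one h).2 hvc, by field_simp⟩
      have e : t * c i + 1 / 2 * (t * c i) ^ 2 * l + t * c i * B + G =
          t * (c i + 1 / 2 * c i ^ 2 * l + c i * B + G) + (1 - t) * G
            + 1 / 2 * (t * (1 - t)) * c i ^ 2 * (-l) := by ring
      rw [e]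
      have := sub_nonneg.2 ht1
      have := neg_pos.2 hl
      positivity
  · rw [g_congr (d := c)]
    · exact g_nonneg_of_mem hc I
    · intro j hj
      exact Function.update_of_ne (fun h : j = i => hi (h ▸ hj)) _ _

/-- The admissible types form a lower set of the positive orthant. -/
theorem admissible_of_le (hP01 : ∀ i j, P i j ∈ Set.Ioo (0 : ℝ) 1) {c d : Fin k → ℝ}
    (hc : c ∈ admissible P) (hd : ∀ i, 0 ≤ d i) (hdc : ∀ i, d i ≤ c i) : d ∈ admissible P := by
  have key : ∀ T : Finset (Fin k), (fun j => if j ∈ T then d j else c j) ∈ admissible P := by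
    intro T
    induction T using Finset.induction_on with
    | empty => simpa using hc
    | insert i T hi ih =>
      have := update_mem_admissible hP01 ih (i := i) (hd i) (by simpa [hi] using hdc i)
      convert this using 1
      funext j
      rcases eq_or_ne j i with rfl | h
      · simp
      · simp [h]
  simpa using key Finset.univ

theorem convexHull_admissible_of_le (hP01 : ∀ i j, P i j ∈ Set.Ioo (0 : ℝ) 1) {c d : Fin k → ℝ}
    (hc : c ∈ convexHull ℝ (admissible P)) (hd : ∀ i, 0 ≤ d i) (hdc : ∀ i, d i ≤ c i) :
    d ∈ convexHull ℝ (admissible P) := by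
  let D : (Fin k → ℝ) →ₗ[ℝ] (Fin k → ℝ) :=
    LinearMap.pi fun i => (d i / c i) • LinearMap.proj i
  have hD : D c = d := by
    funext i
    have h : d i / c i * c i = d i := by
      rcases eq_or_ne (c i) 0 with h | h
      · have := hd i
        have := hdc i
        rw [h] at this ⊢
        linarith
      · field_simp
    simpa [D] using h
  have hsub : D '' admissible P ⊆ admissible P := by
    rintro _ ⟨x, hx, rfl⟩
    have h1 : ∀ i, 0 ≤ d i / c i := fun i => div_nonneg (hd i) ((hd i).trans (hdc i))
    have h2 : ∀ i, d i / c i ≤ 1 := fun i => div_le_one_of_le₀ (hdc i) ((hd i).trans (hdc i))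
    refine admissible_of_le hP01 hx (fun i => ?_) fun i => ?_
    · simpa [D] using mul_nonneg (h1 i) (hx.1 i)
    · simpa [D] using mul_le_of_le_one_left (hx.1 i) (h2 i)
  rw [← hD]
  have := Set.mem_image_of_mem D hc
  rw [LinearMap.image_convexHull] at this
  exact convexHull_mono hsub this

theorem zero_mem_admissible : (0 : Fin k → ℝ) ∈ admissible P :=
  ⟨fun _ => le_rfl, fun I _ => by simp [g]⟩

theorem continuous_g (I : Finset (Fin k)) : Continuous fun c => g P c I := by
  unfold g
  fun_prop

theorem le_of_mem_admissible (hP01 : ∀ i j, P i j ∈ Set.Ioo (0 : ℝ) 1) {c : Fin k → ℝ}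
    (hc : c ∈ admissible P) (i : Fin k) : c i ≤ 2 / -Real.log (1 - P i i) := by
  have h := hc.2 {i} (Finset.singleton_nonempty i)
  have hl := log_one_sub_neg hP01 i i
  simp only [g, Finset.sum_singleton] at h
  rw [le_div_iff₀ (neg_pos.2 hl)]
  rcases (hc.1 i).eq_or_lt with h0 | h0
  · simp [← h0]
  · by_contra! hlt
    nlinarith

theorem isCompact_admissible (hP01 : ∀ i j, P i j ∈ Set.Ioo (0 : ℝ) 1) :
    IsCompact (admissible P) := by
  refine IsCompact.of_isClosed_subset
    (isCompact_univ_pi fun i => isCompact_Icc (a := 0) (b := 2 / -Real.log (1 - P i i))) ?_ ?_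
  · have : admissible P = (⋂ i, {c | 0 ≤ c i}) ∩ ⋂ I : Finset (Fin k), ⋂ _ : I.Nonempty,
        {c | 0 ≤ g P c I} := by
      ext c
      simp [admissible]
    rw [this]
    exact (isClosed_iInter fun i => isClosed_le continuous_const (continuous_apply i)).inter
      (isClosed_iInter fun I => isClosed_iInter fun _ =>
        isClosed_le continuous_const (continuous_g I))
  · intro c hc i _
    exact ⟨hc.1 i, le_of_mem_admissible hP01 hc i⟩

theorem oneNorm_smul {t : ℝ} (ht : 0 ≤ t) (c : Fin k → ℝ) : oneNorm (t • c) = t * oneNorm c := by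
  simp [oneNorm, abs_mul, abs_of_nonneg ht, Finset.mul_sum]

theorem rayNorms_eq (hα1 : oneNorm α = 1) :
    rayNorms α P = {t | 0 ≤ t ∧ t • α ∈ convexHull ℝ (admissible P)} := by
  ext t
  constructor
  · rintro ⟨_, ⟨hc, s, hs, rfl⟩, rfl⟩
    rw [oneNorm_smul hs, hα1, mul_one]
    exact ⟨hs, hc⟩
  · rintro ⟨h0, h⟩
    exact ⟨_, ⟨h, t, h0, rfl⟩, by rw [oneNorm_smul h0, hα1, mul_one]⟩

theorem isGreatest_cStar (hα1 : oneNorm α = 1) (hP01 : ∀ i j, P i j ∈ Set.Ioo (0 : ℝ) 1) :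
    IsGreatest (rayNorms α P) (cStar α P) := by
  have hne : (rayNorms α P).Nonempty := by
    rw [rayNorms_eq hα1]
    exact ⟨0, le_rfl, by simpa using subset_convexHull ℝ _ zero_mem_admissible⟩
  have hcomp : IsCompact (rayNorms α P) := by
    refine ((isCompact_admissible hP01).convexHull_of_finiteDimensional.inter_right ?_).image ?_
    · have : {c : Fin k → ℝ | ∃ t : ℝ, 0 ≤ t ∧ c = t • α} = {c | c = oneNorm c • α} := by
        ext c
        constructor
        · rintro ⟨t, ht, rfl⟩
          simp only [Set.mem_ofPred_eq]
          rw [oneNorm_smul ht, hα1, mul_one]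
        · intro h
          exact ⟨oneNorm c, Finset.sum_nonneg fun _ _ => abs_nonneg _, h⟩
      rw [this]
      apply isClosed_eq continuous_id
      unfold oneNorm
      fun_prop
    · unfold oneNorm
      fun_prop
  exact hcomp.isGreatest_sSup hne

theorem le_cStar (hα1 : oneNorm α = 1) (hP01 : ∀ i j, P i j ∈ Set.Ioo (0 : ℝ) 1) {t : ℝ}
    (ht : 0 ≤ t) (h : t • α ∈ convexHull ℝ (admissible P)) : t ≤ cStar α P :=
  (isGreatest_cStar hα1 hP01).2 (by rw [rayNorms_eq hα1]; exact ⟨ht, h⟩)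

theorem cStar_smul_mem (hα1 : oneNorm α = 1) (hP01 : ∀ i j, P i j ∈ Set.Ioo (0 : ℝ) 1) :
    cStar α P • α ∈ convexHull ℝ (admissible P) := by
  have := (isGreatest_cStar hα1 hP01).1
  rw [rayNorms_eq hα1] at this
  exact this.2

/-- A positive upper bound for the numbers `-ln (1 - p_ij)`. -/
noncomputable def logBound {k : ℕ} (P : Matrix (Fin k) (Fin k) ℝ) : ℝ :=
  1 + ∑ i, ∑ j, |Real.log (1 - P i j)|

theorem logBound_pos : 0 < logBound P := by
  unfold logBound
  positivity

theorem neg_log_le_logBound (i j : Fin k) : -Real.log (1 - P i j) ≤ logBound P := by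
  have h1 : |Real.log (1 - P i j)| ≤ ∑ j, |Real.log (1 - P i j)| :=
    Finset.single_le_sum (f := fun j => |Real.log (1 - P i j)|) (fun _ _ => abs_nonneg _)
      (Finset.mem_univ j)
  have h2 : ∑ j, |Real.log (1 - P i j)| ≤ ∑ i, ∑ j, |Real.log (1 - P i j)| :=
    Finset.single_le_sum (f := fun i => ∑ j, |Real.log (1 - P i j)|)
      (fun _ _ => Finset.sum_nonneg fun _ _ => abs_nonneg _) (Finset.mem_univ i)
  have := neg_le_abs (Real.log (1 - P i j))
  unfold logBound
  linarith

theorem cStar_pos (hα : ∀ i, α i ∈ Set.Ioc (0 : ℝ) 1) (hα1 : oneNorm α = 1)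
    (hP01 : ∀ i j, P i j ∈ Set.Ioo (0 : ℝ) 1) : 0 < cStar α P := by
  have hM := logBound_pos (P := P)
  set t : ℝ := 1 / logBound P with ht
  have ht0 : 0 < t := by positivity
  refine ht0.trans_le (le_cStar hα1 hP01 ht0.le (subset_convexHull ℝ _ ⟨fun i => ?_, fun I _ => ?_⟩))
  · have := (hα i).1
    simp only [Pi.smul_apply, smul_eq_mul]
    positivity
  · have hsum : ∑ i ∈ I, α i ≤ 1 := by
      rw [← hα1, oneNorm]
      calc ∑ i ∈ I, α i ≤ ∑ i, α i :=
            Finset.sum_le_sum_of_subset_of_nonneg (Finset.subset_univ I) fun i _ _ => (hα i).1.le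
        _ ≤ _ := Finset.sum_le_sum fun i _ => le_abs_self _
    have hsum0 : 0 ≤ ∑ i ∈ I, α i := Finset.sum_nonneg fun i _ => (hα i).1.le
    have hQ : ∑ i ∈ I, ∑ j ∈ I, (t • α) i * (t • α) j * Real.log (1 - P i j)
        ≥ ∑ i ∈ I, ∑ j ∈ I, (t • α) i * (t • α) j * (-logBound P) := by
      refine Finset.sum_le_sum fun i _ => Finset.sum_le_sum fun j _ => ?_
      have := (hα i).1
      have := (hα j).1
      refine mul_le_mul_of_nonneg_left (by linarith [neg_log_le_logBound (P := P) i j]) ?_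
      simp only [Pi.smul_apply, smul_eq_mul]
      positivity
    have e : ∑ i ∈ I, ∑ j ∈ I, (t • α) i * (t • α) j * (-logBound P)
        = - (t * (∑ i ∈ I, α i) ^ 2) := by
      rw [pow_two, Finset.sum_mul_sum, Finset.mul_sum, ← Finset.sum_neg_distrib]
      refine Finset.sum_congr rfl fun i _ => ?_
      rw [Finset.mul_sum, ← Finset.sum_neg_distrib]
      refine Finset.sum_congr rfl fun j _ => ?_
      simp only [Pi.smul_apply, smul_eq_mul]
      have : t * logBound P = 1 := by rw [ht]; field_simp
      linear_combination (-α i * α j * t) * this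
    unfold g
    have e2 : ∑ i ∈ I, (t • α) i = t * ∑ i ∈ I, α i := by simp [Finset.mul_sum]
    rw [e] at hQ
    rw [e2]
    nlinarith [mul_nonneg ht0.le hsum0, mul_nonneg (mul_nonneg ht0.le hsum0) (sub_nonneg.2 hsum)]

section Bits

variable {E : Type*}

/-- The indicator of the event that all the bits in `F` are `false`. -/
def offInd (F : Finset E) (ω : E → Bool) : ℝ := if ∀ e ∈ F, ω e = false then 1 else 0

theorem offInd_nonneg (F : Finset E) (ω : E → Bool) : 0 ≤ offInd F ω := by
  unfold offInd
  split_ifs <;> norm_num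

theorem antitone_offInd (F : Finset E) : Antitone (offInd F) := by
  intro ω ω' h
  unfold offInd
  split_ifs with h1 h2
  · exact le_rfl
  · refine absurd (fun e he => ?_) h2
    have := h e
    rw [h1 e he] at this
    cases hω : ω e
    · rfl
    · rw [hω] at this
      exact absurd (this rfl) Bool.false_ne_true
  · norm_num
  · exact le_rfl

theorem offInd_mul_offInd_le (F : Finset E) (a b : E → Bool) :
    offInd F a * offInd F b ≤ offInd F (a ⊓ b) * offInd F (a ⊔ b) := by
  by_cases h : (∀ e ∈ F, a e = false) ∧ ∀ e ∈ F, b e = false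
  · have h1 : ∀ e ∈ F, (a ⊓ b) e = false := fun e he => by simp [h.1 e he]
    have h2 : ∀ e ∈ F, (a ⊔ b) e = false := fun e he => by simp [h.1 e he, h.2 e he]
    unfold offInd
    rw [if_pos h.1, if_pos h.2, if_pos h1, if_pos h2]
  · have : offInd F a * offInd F b = 0 := by
      unfold offInd
      rw [not_and_or] at h
      rcases h with h | h <;> rw [if_neg h] <;> simp
    rw [this]
    exact mul_nonneg (offInd_nonneg _ _) (offInd_nonneg _ _)

theorem monotone_exp_neg_mul_sum_offInd {ι : Type*} {s : ℝ} (hs : 0 ≤ s) (F : ι → Finset E)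
    (T : Finset ι) :
    Monotone fun ω => Real.exp (-(s * ∑ j ∈ T, offInd (F j) ω)) := by
  intro ω ω' h
  refine Real.exp_le_exp.2 (neg_le_neg (mul_le_mul_of_nonneg_left ?_ hs))
  exact Finset.sum_le_sum fun j _ => antitone_offInd (F j) h

variable [DecidableEq E]

theorem offInd_union (F F' : Finset E) (ω : E → Bool) :
    offInd (F ∪ F') ω = offInd F ω * offInd F' ω := by
  unfold offInd
  by_cases h1 : ∀ e ∈ F, ω e = false <;> by_cases h2 : ∀ e ∈ F', ω e = false <;>
    simp only [Finset.mem_union, or_imp, forall_and, h1, h2] <;> simp_all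

theorem offInd_insert (e : E) (F : Finset E) (ω : E → Bool) :
    offInd (insert e F) ω = offInd {e} ω * offInd F ω := by
  rw [← offInd_union, Finset.insert_eq]

end Bits

section Product

variable {E : Type*} [Fintype E]

/-- The probability of the outcome `ω` of independent bits, the bit `e` being `true` with
probability `p e`. -/
def bitWeight (p : E → ℝ) (ω : E → Bool) : ℝ := ∏ e, if ω e then p e else 1 - p e

variable {p : E → ℝ}

theorem bitWeight_nonneg (hp : ∀ e, p e ∈ Set.Ioo (0 : ℝ) 1) (ω : E → Bool) :
    0 ≤ bitWeight p ω := by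
  refine Finset.prod_nonneg fun e _ => ?_
  have := (hp e).1
  have := (hp e).2
  split_ifs <;> linarith

theorem bitWeight_mul_bitWeight (a b : E → Bool) :
    bitWeight p a * bitWeight p b = bitWeight p (a ⊓ b) * bitWeight p (a ⊔ b) := by
  unfold bitWeight
  rw [← Finset.prod_mul_distrib, ← Finset.prod_mul_distrib]
  refine Finset.prod_congr rfl fun e _ => ?_
  have key : ∀ x y : Bool, (if x then p e else 1 - p e) * (if y then p e else 1 - p e)
      = (if x ⊓ y then p e else 1 - p e) * (if x ⊔ y then p e else 1 - p e) := by
    intro x y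
    cases x <;> cases y <;> simp [mul_comm]
  exact key (a e) (b e)

variable [DecidableEq E]

theorem sum_bitWeight : ∑ ω, bitWeight p ω = 1 := by
  have := Finset.prod_univ_sum (fun _ : E => (Finset.univ : Finset Bool))
    (fun e b => if b then p e else 1 - p e)
  rw [Fintype.piFinset_univ] at this
  unfold bitWeight
  rw [← this]
  simp

theorem bitWeight_eq_mul (ω : E → Bool) (e : E) : bitWeight p ω =
    (if ω e then p e else 1 - p e) * ∏ x ∈ Finset.univ.erase e, if ω x then p x else 1 - p x :=
  (Finset.mul_prod_erase _ _ (Finset.mem_univ e)).symm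

theorem sum_offInd_singleton_mul (e : E) (h : (E → Bool) → ℝ)
    (hh : ∀ ω b, h (Function.update ω e b) = h ω) :
    ∑ ω, bitWeight p ω * (offInd {e} ω * h ω) = (1 - p e) * ∑ ω, bitWeight p ω * h ω := by
  have hinv : Function.Involutive (fun ω : E → Bool => Function.update ω e (!ω e)) := by
    intro ω
    simp
  set φ : Equiv.Perm (E → Bool) := Function.Involutive.toPerm _ hinv with hφ
  have hflip := Equiv.sum_comp φ fun ω : E → Bool => bitWeight p ω * ((1 - offInd {e} ω) * h ω)
  have hpt : ∀ ω : E → Bool, (1 - p e) * (bitWeight p (φ ω) *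
      ((1 - offInd {e} (φ ω)) * h (φ ω)))
      = p e * (bitWeight p ω * (offInd {e} ω * h ω)) := by
    intro ω
    have h1 : φ ω = Function.update ω e (!ω e) := rfl
    rw [h1, hh, bitWeight_eq_mul _ e, bitWeight_eq_mul ω e]
    have h2 : ∏ x ∈ Finset.univ.erase e,
        (if Function.update ω e (!ω e) x then p x else 1 - p x)
        = ∏ x ∈ Finset.univ.erase e, if ω x then p x else 1 - p x :=
      Finset.prod_congr rfl fun x hx => by
        rw [Function.update_of_ne (Finset.ne_of_mem_erase hx)]
    rw [h2]
    cases hω : ω e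
    · simp [offInd, hω]
      ring
    · simp [offInd, hω]
  have hsum : (1 - p e) * ∑ ω, bitWeight p ω * ((1 - offInd {e} ω) * h ω)
      = p e * ∑ ω, bitWeight p ω * (offInd {e} ω * h ω) := by
    rw [← hflip, Finset.mul_sum, Finset.mul_sum]
    exact Finset.sum_congr rfl fun ω _ => hpt ω
  have hsplit : ∑ ω, bitWeight p ω * h ω = ∑ ω, bitWeight p ω * (offInd {e} ω * h ω)
      + ∑ ω, bitWeight p ω * ((1 - offInd {e} ω) * h ω) := by
    rw [← Finset.sum_add_distrib]
    exact Finset.sum_congr rfl fun ω _ => by ring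
  rw [hsplit, mul_add, hsum]
  ring

/-- The event that the bits in `F` are `false` is independent of the bits outside `F`. -/
theorem sum_offInd_mul (F : Finset E) (h : (E → Bool) → ℝ)
    (hh : ∀ e ∈ F, ∀ ω b, h (Function.update ω e b) = h ω) :
    ∑ ω, bitWeight p ω * (offInd F ω * h ω) = (∏ e ∈ F, (1 - p e)) * ∑ ω, bitWeight p ω * h ω := by
  induction F using Finset.induction_on with
  | empty => simp [offInd]
  | insert e F he ih =>
    simp only [Finset.mem_insert, forall_eq_or_imp] at hh
    rw [Finset.prod_insert he, mul_assoc, ← ih hh.2, ← sum_offInd_singleton_mul]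
    · simp only [offInd_insert, mul_assoc]
    · intro ω b
      rw [hh.1]
      congr 1
      unfold offInd
      congr 1
      refine propext (forall₂_congr fun x hx => ?_)
      rw [Function.update_of_ne]
      rintro rfl
      exact he hx

theorem sum_bitWeight_mul_offInd (F : Finset E) :
    ∑ ω, bitWeight p ω * offInd F ω = ∏ e ∈ F, (1 - p e) := by
  simpa [sum_bitWeight] using sum_offInd_mul (p := p) F (fun _ => 1) (fun _ _ _ _ => rfl)

variable {ι : Type*} [Fintype ι]

theorem le_sum_offInd_mul_exp (hp : ∀ e, p e ∈ Set.Ioo (0 : ℝ) 1) (F : ι → Finset E) {s : ℝ}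
    (hs : 0 ≤ s) (i : ι) :
    (∏ e ∈ F i, (1 - p e) - s * ∑ j with ¬Disjoint (F i) (F j), ∏ e ∈ F i ∪ F j, (1 - p e)) *
      ∑ ω, bitWeight p ω * Real.exp (-(s * ∑ j, offInd (F j) ω)) ≤
    ∑ ω, bitWeight p ω * (offInd (F i) ω * Real.exp (-(s * ∑ j, offInd (F j) ω))) := by
  classical
  set T := Finset.univ.filter fun j => ¬Disjoint (F i) (F j)
  set T' := Finset.univ.filter fun j => ¬¬Disjoint (F i) (F j)
  set eY : (E → Bool) → ℝ := fun ω => Real.exp (-(s * ∑ j ∈ T, offInd (F j) ω)) with heY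
  set eZ : (E → Bool) → ℝ := fun ω => Real.exp (-(s * ∑ j ∈ T', offInd (F j) ω)) with heZ
  have hX : ∀ ω, Real.exp (-(s * ∑ j, offInd (F j) ω)) = eY ω * eZ ω := by
    intro ω
    rw [heY, heZ, ← Real.exp_add, ← Finset.sum_filter_add_sum_filter_not Finset.univ
      (fun j => ¬Disjoint (F i) (F j))]
    congr 1
    ring
  have hpi : 0 < ∏ e ∈ F i, (1 - p e) := Finset.prod_pos fun e _ => by linarith [(hp e).2]
  have hw := bitWeight_nonneg hp
  have hfkg := fkg (μ := fun ω => bitWeight p ω * offInd (F i) ω) (f := eY) (g := eZ)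
    (fun ω => mul_nonneg (hw ω) (offInd_nonneg _ _)) (fun ω => (Real.exp_pos _).le)
    (fun ω => (Real.exp_pos _).le) (monotone_exp_neg_mul_sum_offInd hs F T)
    (monotone_exp_neg_mul_sum_offInd hs F T') (fun a b => by
      calc bitWeight p a * offInd (F i) a * (bitWeight p b * offInd (F i) b)
          = bitWeight p a * bitWeight p b * (offInd (F i) a * offInd (F i) b) := by ring
        _ ≤ bitWeight p (a ⊓ b) * bitWeight p (a ⊔ b) *
            (offInd (F i) (a ⊓ b) * offInd (F i) (a ⊔ b)) := by
          rw [bitWeight_mul_bitWeight]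
          exact mul_le_mul_of_nonneg_left (offInd_mul_offInd_le _ _ _) (mul_nonneg (hw _) (hw _))
        _ = _ := by ring)
  have hZ : ∑ ω, bitWeight p ω * offInd (F i) ω * eZ ω
      = (∏ e ∈ F i, (1 - p e)) * ∑ ω, bitWeight p ω * eZ ω := by
    rw [← sum_offInd_mul]
    · simp only [mul_assoc]
    · intro e he ω b
      simp only [heZ]
      congr 3
      refine Finset.sum_congr rfl fun j hj => ?_
      unfold offInd
      congr 1
      refine propext (forall₂_congr fun x hx => ?_)
      rw [Function.update_of_ne]
      rintro rfl
      exact Finset.disjoint_left.1 (not_not.1 (Finset.mem_filter.1 hj).2) he hx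
  rw [sum_bitWeight_mul_offInd, hZ] at hfkg
  have h1 : (∑ ω, bitWeight p ω * offInd (F i) ω * eY ω) * ∑ ω, bitWeight p ω * eZ ω
      ≤ ∑ ω, bitWeight p ω * offInd (F i) ω * (eY ω * eZ ω) := by
    refine le_of_mul_le_mul_left ?_ hpi
    linarith
  have hY0 : 0 ≤ ∑ ω, bitWeight p ω * offInd (F i) ω * eY ω := Finset.sum_nonneg fun ω _ =>
    mul_nonneg (mul_nonneg (hw ω) (offInd_nonneg _ _)) (Real.exp_pos _).le
  have hΨ0 : 0 ≤ ∑ ω, bitWeight p ω * (eY ω * eZ ω) := Finset.sum_nonneg fun ω _ =>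
    mul_nonneg (hw ω) (mul_nonneg (Real.exp_pos _).le (Real.exp_pos _).le)
  have hΨZ : ∑ ω, bitWeight p ω * (eY ω * eZ ω) ≤ ∑ ω, bitWeight p ω * eZ ω := by
    refine Finset.sum_le_sum fun ω _ => mul_le_mul_of_nonneg_left ?_ (hw ω)
    refine mul_le_of_le_one_left (Real.exp_pos _).le (Real.exp_le_one_iff.2 ?_)
    exact neg_nonpos.2 (mul_nonneg hs (Finset.sum_nonneg fun j _ => offInd_nonneg _ _))
  have hY : ∏ e ∈ F i, (1 - p e) - s * ∑ j ∈ T, ∏ e ∈ F i ∪ F j, (1 - p e)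
      ≤ ∑ ω, bitWeight p ω * offInd (F i) ω * eY ω := by
    have : ∏ e ∈ F i, (1 - p e) - s * ∑ j ∈ T, ∏ e ∈ F i ∪ F j, (1 - p e)
        = ∑ ω, bitWeight p ω * offInd (F i) ω * (1 - s * ∑ j ∈ T, offInd (F j) ω) := by
      have h2 : ∀ j, ∏ e ∈ F i ∪ F j, (1 - p e)
          = ∑ ω, bitWeight p ω * (offInd (F i) ω * offInd (F j) ω) := fun j => by
        simp only [← sum_bitWeight_mul_offInd, offInd_union]
      simp only [h2]
      rw [Finset.sum_comm, ← sum_bitWeight_mul_offInd, Finset.mul_sum, ← Finset.sum_sub_distrib]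
      refine Finset.sum_congr rfl fun ω _ => ?_
      simp only [← Finset.mul_sum]
      ring
    rw [this]
    refine Finset.sum_le_sum fun ω _ =>
      mul_le_mul_of_nonneg_left ?_ (mul_nonneg (hw ω) (offInd_nonneg _ _))
    have := Real.add_one_le_exp (-(s * ∑ j ∈ T, offInd (F j) ω))
    simp only [heY]
    linarith
  simp only [hX]
  calc _ ≤ (∑ ω, bitWeight p ω * offInd (F i) ω * eY ω) * ∑ ω, bitWeight p ω * (eY ω * eZ ω) :=
        mul_le_mul_of_nonneg_right hY hΨ0
    _ ≤ (∑ ω, bitWeight p ω * offInd (F i) ω * eY ω) * ∑ ω, bitWeight p ω * eZ ω :=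
        mul_le_mul_of_nonneg_left hΨZ hY0
    _ ≤ _ := h1
    _ = _ := by simp only [mul_assoc]

/-- **Janson's inequality** for independent bits: an exponential bound for the probability that
none of the sets `F i` consists of `false` bits only. -/
theorem janson (hp : ∀ e, p e ∈ Set.Ioo (0 : ℝ) 1) (F : ι → Finset E) {Δ : ℝ} (hΔ0 : 0 < Δ)
    (hΔ : ∑ i, ∑ j with ¬Disjoint (F i) (F j), ∏ e ∈ F i ∪ F j, (1 - p e) ≤ Δ) :
    ∑ ω with ∀ i, offInd (F i) ω = 0, bitWeight p ω
      ≤ Real.exp (-((∑ i, ∏ e ∈ F i, (1 - p e)) ^ 2 / (2 * Δ))) := by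
  set m := ∑ i, ∏ e ∈ F i, (1 - p e) with hm
  have hm0 : 0 ≤ m := Finset.sum_nonneg fun i _ => Finset.prod_nonneg fun e _ => by
    linarith [(hp e).2]
  have hw := bitWeight_nonneg hp
  set X : (E → Bool) → ℝ := fun ω => ∑ j, offInd (F j) ω with hXdef
  set Ψ : ℝ → ℝ := fun s => ∑ ω, bitWeight p ω * Real.exp (-(s * X ω)) with hΨ
  have hΨ' : ∀ s, HasDerivAt Ψ (∑ ω, bitWeight p ω * (Real.exp (-(s * X ω)) * -(X ω))) s := by
    intro s
    refine HasDerivAt.fun_sum fun ω _ => ?_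
    have : HasDerivAt (fun s : ℝ => -(s * X ω)) (-(1 * X ω)) s :=
      ((hasDerivAt_id s).mul_const (X ω)).neg
    simpa using (this.exp.const_mul (bitWeight p ω))
  have hΨ0 : ∀ s, 0 ≤ Ψ s := fun s => Finset.sum_nonneg fun ω _ =>
    mul_nonneg (hw ω) (Real.exp_pos _).le
  have hineq : ∀ s, 0 ≤ s → (m - s * Δ) * Ψ s
      ≤ ∑ ω, bitWeight p ω * (Real.exp (-(s * X ω)) * X ω) := by
    intro s hs
    have h1 := Finset.sum_le_sum fun i (_ : i ∈ Finset.univ) => le_sum_offInd_mul_exp hp F hs i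
    rw [← Finset.sum_mul, Finset.sum_sub_distrib, ← Finset.mul_sum, Finset.sum_comm] at h1
    calc (m - s * Δ) * Ψ s ≤ _ := mul_le_mul_of_nonneg_right
          (sub_le_sub_left (mul_le_mul_of_nonneg_left hΔ hs) _) (hΨ0 s)
      _ ≤ _ := h1
      _ = _ := by
        refine Finset.sum_congr rfl fun ω _ => ?_
        rw [← Finset.mul_sum, ← Finset.sum_mul, mul_comm (Real.exp _)]
  set H : ℝ → ℝ := fun s => Ψ s * Real.exp (m * s - s ^ 2 * Δ / 2) with hH
  have hH' : ∀ s, HasDerivAt H ((∑ ω, bitWeight p ω * (Real.exp (-(s * X ω)) * -(X ω))) *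
      Real.exp (m * s - s ^ 2 * Δ / 2) +
      Ψ s * (Real.exp (m * s - s ^ 2 * Δ / 2) * (m - s * Δ))) s := by
    intro s
    refine (hΨ' s).mul (HasDerivAt.exp ?_)
    have h1 : HasDerivAt (fun s : ℝ => m * s - s ^ 2 * Δ / 2)
        (m * 1 - ((2 : ℕ) * s ^ (2 - 1) * 1) * Δ / 2) s :=
      ((hasDerivAt_id s).const_mul m).sub ((((hasDerivAt_id s).pow 2).mul_const Δ).div_const 2)
    convert h1 using 1
    norm_num
    ring
  have hanti : AntitoneOn H (Set.Ici 0) := by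
    refine antitoneOn_of_deriv_nonpos (convex_Ici 0)
      (fun s _ => (hH' s).continuousAt.continuousWithinAt)
      (fun s _ => (hH' s).differentiableAt.differentiableWithinAt) fun s hs => ?_
    rw [interior_Ici] at hs
    rw [(hH' s).deriv]
    have h1 := hineq s (le_of_lt hs)
    have h2 : ∑ ω, bitWeight p ω * (Real.exp (-(s * X ω)) * -(X ω))
        = - ∑ ω, bitWeight p ω * (Real.exp (-(s * X ω)) * X ω) := by
      rw [← Finset.sum_neg_distrib]
      exact Finset.sum_congr rfl fun ω _ => by ring
    rw [h2]
    have h3 := Real.exp_pos (m * s - s ^ 2 * Δ / 2)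
    nlinarith
  have hs0 : 0 ≤ m / Δ := by positivity
  have hle := hanti (Set.mem_Ici.2 le_rfl) (Set.mem_Ici.2 hs0) hs0
  have hH0 : H 0 = 1 := by simp [hH, hΨ, sum_bitWeight]
  have hexp : m * (m / Δ) - (m / Δ) ^ 2 * Δ / 2 = m ^ 2 / (2 * Δ) := by
    field_simp
    ring
  rw [hH0] at hle
  simp only [hH, hexp] at hle
  calc ∑ ω with ∀ i, offInd (F i) ω = 0, bitWeight p ω
      = ∑ ω with ∀ i, offInd (F i) ω = 0, bitWeight p ω * Real.exp (-(m / Δ * X ω)) := by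
        refine Finset.sum_congr rfl fun ω hω => ?_
        have : X ω = 0 := Finset.sum_eq_zero fun i _ => (Finset.mem_filter.1 hω).2 i
        simp [this]
    _ ≤ Ψ (m / Δ) := Finset.sum_le_sum_of_subset_of_nonneg (Finset.filter_subset _ _)
        fun ω _ _ => mul_nonneg (hw ω) (Real.exp_pos _).le
    _ ≤ _ := by
        rw [Real.exp_neg, ← one_div, le_div_iff₀ (Real.exp_pos _)]
        exact hle

end Product

section Pairs

variable {X : Type*} [DecidableEq X]

/-- The unordered pairs of distinct elements of `S`. -/
def pairs (S : Finset X) : Finset (Sym2 X) := S.sym2.filter fun e => ¬e.IsDiag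

theorem mk_mem_pairs {S : Finset X} {u v : X} : s(u, v) ∈ pairs S ↔ u ∈ S ∧ v ∈ S ∧ u ≠ v := by
  simp [pairs, and_assoc]

theorem sum_offDiag_eq_two_mul_sum_pairs (S : Finset X) (f : Sym2 X → ℝ) :
    ∑ x ∈ S.offDiag, f s(x.1, x.2) = 2 * ∑ e ∈ pairs S, f e := by
  have hmaps : ∀ x ∈ S.offDiag, s(x.1, x.2) ∈ pairs S := fun x hx => by
    simpa [mk_mem_pairs] using hx
  rw [← Finset.sum_fiberwise_of_maps_to hmaps, Finset.mul_sum]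
  refine Finset.sum_congr rfl fun e he => ?_
  induction e with
  | _ a b =>
    rw [mk_mem_pairs] at he
    have hfib : S.offDiag.filter (fun x => s(x.1, x.2) = s(a, b)) = {(a, b), (b, a)} := by
      ext ⟨x, y⟩
      simp only [Finset.mem_filter, Finset.mem_offDiag, Sym2.eq_iff, Finset.mem_insert,
        Finset.mem_singleton, Prod.mk.injEq]
      constructor
      · rintro ⟨-, h⟩
        exact h
      · rintro (⟨rfl, rfl⟩ | ⟨rfl, rfl⟩)
        · exact ⟨he, Or.inl ⟨rfl, rfl⟩⟩
        · exact ⟨⟨he.2.1, he.1, he.2.2.symm⟩, Or.inr ⟨rfl, rfl⟩⟩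
    rw [hfib, Finset.sum_pair (by simp [he.2.2]), Sym2.eq_swap (a := b)]
    ring

theorem sum_pairs (S : Finset X) (f : Sym2 X → ℝ) :
    ∑ e ∈ pairs S, f e = 1 / 2 * ∑ u ∈ S, ∑ v ∈ S, f s(u, v) - 1 / 2 * ∑ u ∈ S, f s(u, u) := by
  have h := sum_offDiag_eq_two_mul_sum_pairs S f
  have h2 : ∑ u ∈ S, ∑ v ∈ S, f s(u, v) = ∑ u ∈ S, f s(u, u) + ∑ x ∈ S.offDiag, f s(x.1, x.2) := by
    rw [← Finset.sum_product', ← Finset.diag_union_offDiag,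
      Finset.sum_union (Finset.disjoint_diag_offDiag S), Finset.sum_diag]
  rw [h2, h]
  ring

end Pairs

section Blocks

variable {X : Type*}

/-- The number of elements of `S` in the `i`-th block, where `τ` tells the block of an element. -/
def blockCount (τ : X → Fin k) (S : Finset X) (i : Fin k) : ℕ := (S.filter fun u => τ u = i).card

theorem sum_comp_block (τ : X → Fin k) (S : Finset X) (f : Fin k → ℝ) :
    ∑ u ∈ S, f (τ u) = ∑ i, blockCount τ S i * f i := by
  rw [← Finset.sum_fiberwise S τ]
  refine Finset.sum_congr rfl fun i _ => ?_
  rw [Finset.sum_congr rfl fun u hu => by rw [(Finset.mem_filter.1 hu).2], Finset.sum_const,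
    nsmul_eq_mul]
  rfl

theorem sum_blockCount (τ : X → Fin k) (S : Finset X) : ∑ i, (blockCount τ S i : ℝ) = S.card := by
  simpa using (sum_comp_block τ S fun _ => 1).symm

/-- The edge probabilities on a set whose elements are sorted into blocks by `τ`. -/
def blockProb (hP : P.IsSymm) (τ : X → Fin k) : Sym2 X → ℝ :=
  Sym2.lift ⟨fun u v => P (τ u) (τ v), fun u v => hP.apply (τ v) (τ u)⟩

theorem edgeProb_eq_blockProb (α : Fin k → ℝ) (hP : P.IsSymm) (n : ℕ) :
    edgeProb α P hP n = blockProb hP Sigma.fst := rfl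

theorem blockProb_mk (hP : P.IsSymm) (τ : X → Fin k) (u v : X) :
    blockProb hP τ s(u, v) = P (τ u) (τ v) := rfl

theorem blockProb_mem (hP : P.IsSymm) (hP01 : ∀ i j, P i j ∈ Set.Ioo (0 : ℝ) 1) (τ : X → Fin k)
    (e : Sym2 X) : blockProb hP τ e ∈ Set.Ioo (0 : ℝ) 1 := by
  induction e with
  | _ u v => exact hP01 _ _

/-- The quadratic form `∑_{i,j} t_i t_j (-ln (1 - p_ij))`. -/
noncomputable def quad {k : ℕ} (P : Matrix (Fin k) (Fin k) ℝ) (t : Fin k → ℝ) : ℝ :=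
  ∑ i, ∑ j, t i * t j * -Real.log (1 - P i j)

theorem quad_smul (a : ℝ) (t : Fin k → ℝ) : quad P (a • t) = a ^ 2 * quad P t := by
  simp only [quad, Finset.mul_sum, Pi.smul_apply, smul_eq_mul]
  exact Finset.sum_congr rfl fun i _ => Finset.sum_congr rfl fun j _ => by ring

theorem g_univ (c : Fin k → ℝ) : g P c Finset.univ = ∑ i, c i - 1 / 2 * quad P c := by
  simp [g, quad, Finset.sum_neg_distrib]

theorem quad_le {t : Fin k → ℝ} (ht : ∀ i, 0 ≤ t i) : quad P t ≤ logBound P * (∑ i, t i) ^ 2 := by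
  rw [pow_two, Finset.sum_mul_sum, Finset.mul_sum]
  refine Finset.sum_le_sum fun i _ => ?_
  rw [Finset.mul_sum]
  refine Finset.sum_le_sum fun j _ => ?_
  rw [mul_comm (logBound P)]
  exact mul_le_mul_of_nonneg_left (neg_log_le_logBound i j) (mul_nonneg (ht i) (ht j))

theorem prod_pairs_eq_exp [DecidableEq X] (hP : P.IsSymm)
    (hP01 : ∀ i j, P i j ∈ Set.Ioo (0 : ℝ) 1) (τ : X → Fin k) (S : Finset X) :
    ∏ e ∈ pairs S, (1 - blockProb hP τ e) =
      Real.exp (-(1 / 2 * quad P (fun i => blockCount τ S i))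
        + 1 / 2 * ∑ u ∈ S, -Real.log (1 - P (τ u) (τ u))) := by
  have h1 : ∏ e ∈ pairs S, (1 - blockProb hP τ e)
      = Real.exp (∑ e ∈ pairs S, Real.log (1 - blockProb hP τ e)) := by
    rw [Real.exp_sum]
    refine Finset.prod_congr rfl fun e _ => (Real.exp_log ?_).symm
    linarith [(blockProb_mem hP hP01 τ e).2]
  rw [h1, sum_pairs]
  simp only [blockProb_mk]
  have h2 : ∑ u ∈ S, ∑ v ∈ S, Real.log (1 - P (τ u) (τ v))
      = - quad P (fun i => blockCount τ S i) := by
    rw [sum_comp_block τ S fun i => ∑ v ∈ S, Real.log (1 - P i (τ v)), quad,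
      ← Finset.sum_neg_distrib]
    refine Finset.sum_congr rfl fun i _ => ?_
    rw [sum_comp_block τ S fun j => Real.log (1 - P i j), Finset.mul_sum,
      ← Finset.sum_neg_distrib]
    exact Finset.sum_congr rfl fun j _ => by ring
  rw [h2, Finset.sum_neg_distrib]
  congr 1
  ring

theorem prod_pairs_le [DecidableEq X] (hP : P.IsSymm)
    (hP01 : ∀ i j, P i j ∈ Set.Ioo (0 : ℝ) 1) (τ : X → Fin k) (S : Finset X) :
    ∏ e ∈ pairs S, (1 - blockProb hP τ e) ≤
      Real.exp (-(1 / 2 * quad P (fun i => blockCount τ S i)) + logBound P / 2 * S.card) := by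
  rw [prod_pairs_eq_exp hP hP01]
  refine Real.exp_le_exp.2 (add_le_add_right ?_ _)
  have := Finset.sum_le_card_nsmul S (fun u => -Real.log (1 - P (τ u) (τ u))) (logBound P)
    fun u _ => neg_log_le_logBound _ _
  rw [nsmul_eq_mul] at this
  linarith

theorem le_prod_pairs [DecidableEq X] (hP : P.IsSymm)
    (hP01 : ∀ i j, P i j ∈ Set.Ioo (0 : ℝ) 1) (τ : X → Fin k) (S : Finset X) :
    Real.exp (-(1 / 2 * quad P (fun i => blockCount τ S i))) ≤
      ∏ e ∈ pairs S, (1 - blockProb hP τ e) := by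
  rw [prod_pairs_eq_exp hP hP01]
  refine Real.exp_le_exp.2 (le_add_of_nonneg_right ?_)
  have := Finset.sum_nonneg fun u (_ : u ∈ S) => (neg_pos.2 (log_one_sub_neg hP01 (τ u) (τ u))).le
  linarith

end Blocks

section Events

variable {V : Type*}

/-- The graph whose edges are the pairs with a `true` bit. -/
def graphOf (ω : Sym2 V → Bool) : SimpleGraph V := SimpleGraph.fromEdgeSet {e | ω e = true}

variable [DecidableEq V]

theorem graphOf_isIndepSet_iff (ω : Sym2 V → Bool) (S : Finset V) :
    (graphOf ω).IsIndepSet (S : Set V) ↔ ∀ e ∈ pairs S, ω e = false := by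
  constructor
  · intro h e he
    induction e with
    | _ u v =>
      rw [mk_mem_pairs] at he
      have := h he.1 he.2.1 he.2.2
      simpa [graphOf, he.2.2] using this
  · intro h u hu v hv huv
    have := h _ (mk_mem_pairs.2 ⟨hu, hv, huv⟩)
    simp [graphOf, this]

variable [Fintype V]

open Classical in
/-- The probability that the random graph with edge probabilities `p` has the property `Q`. -/
noncomputable def graphProb (p : Sym2 V → ℝ) (Q : SimpleGraph V → Prop) : ℝ :=
  ∑ ω with Q (graphOf ω), bitWeight p ω

variable {p : Sym2 V → ℝ}

theorem graphProb_mono (hp : ∀ e, p e ∈ Set.Ioo (0 : ℝ) 1) {Q Q' : SimpleGraph V → Prop}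
    (h : ∀ G, Q G → Q' G) : graphProb p Q ≤ graphProb p Q' := by
  classical
  exact Finset.sum_le_sum_of_subset_of_nonneg
    (Finset.monotone_filter_right _ fun _ _ hω => h _ hω) fun ω _ _ => bitWeight_nonneg hp ω

theorem graphProb_nonneg (hp : ∀ e, p e ∈ Set.Ioo (0 : ℝ) 1) (Q : SimpleGraph V → Prop) :
    0 ≤ graphProb p Q :=
  Finset.sum_nonneg fun ω _ => bitWeight_nonneg hp ω

theorem graphProb_add_not (Q : SimpleGraph V → Prop) :
    graphProb p Q + graphProb p (fun G => ¬Q G) = 1 := by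
  classical
  rw [← sum_bitWeight (p := p), ← Finset.sum_filter_add_sum_filter_not _ fun ω => Q (graphOf ω)]
  unfold graphProb
  congr!

theorem graphProb_exists_le (hp : ∀ e, p e ∈ Set.Ioo (0 : ℝ) 1) {ι : Type*} (T : Finset ι)
    (Q : ι → SimpleGraph V → Prop) :
    graphProb p (fun G => ∃ i ∈ T, Q i G) ≤ ∑ i ∈ T, graphProb p (Q i) := by
  classical
  unfold graphProb
  simp only [Finset.sum_filter]
  rw [Finset.sum_comm]
  refine Finset.sum_le_sum fun ω _ => ?_
  have h0 : ∀ i ∈ T, 0 ≤ if Q i (graphOf ω) then bitWeight p ω else 0 := fun i _ => by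
    split_ifs
    exacts [bitWeight_nonneg hp ω, le_rfl]
  split_ifs with h
  · obtain ⟨i, hi, hQ⟩ := h
    refine le_trans ?_ (Finset.single_le_sum h0 hi)
    rw [if_pos hQ]
  · exact Finset.sum_nonneg h0

theorem graphProb_isIndepSet (S : Finset V) :
    graphProb p (fun G => G.IsIndepSet (S : Set V)) = ∏ e ∈ pairs S, (1 - p e) := by
  rw [← sum_bitWeight_mul_offInd, graphProb, Finset.sum_filter]
  refine Finset.sum_congr rfl fun ω _ => ?_
  simp only [graphOf_isIndepSet_iff, offInd]
  split_ifs <;> simp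

end Events

section Law

theorem ofReal_graphProb_le_law (hP : P.IsSymm) (hP01 : ∀ i j, P i j ∈ Set.Ioo (0 : ℝ) 1) (n : ℕ)
    (Q : SimpleGraph (Vertex α n) → Prop) :
    ENNReal.ofReal (graphProb (edgeProb α P hP n) Q) ≤ law α P hP n {G | Q G} := by
  classical
  have hp : ∀ e, edgeProb α P hP n e ∈ Set.Ioo (0 : ℝ) 1 := blockProb_mem hP hP01 Sigma.fst
  refine le_trans ?_ (Measure.le_map_apply (measurable_of_finite _).aemeasurable _)
  set μ := Measure.pi fun e : Sym2 (Vertex α n) =>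
      ProbabilityTheory.bernoulliMeasure true false
        (Set.projIcc (0 : ℝ) 1 zero_le_one (edgeProb α P hP n e))
  have hsing : ∀ ω, μ {ω} = ENNReal.ofReal (bitWeight (edgeProb α P hP n) ω) := by
    intro ω
    rw [Measure.pi_singleton, bitWeight, ENNReal.ofReal_prod_of_nonneg]
    · refine Finset.prod_congr rfl fun e _ => ?_
      have he := hp e
      rw [Set.projIcc_of_mem zero_le_one ⟨he.1.le, he.2.le⟩, ← ofReal_measureReal]
      cases hω : ω e <;> simp
    · intro e _
      have he := hp e
      split_ifs <;> linarith [he.1, he.2]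
  have hset : (fun ω => SimpleGraph.fromEdgeSet {e | ω e = true}) ⁻¹' {G | Q G}
      = ((Finset.univ.filter fun ω : Sym2 (Vertex α n) → Bool => Q (graphOf ω) : Finset _) :
        Set (Sym2 (Vertex α n) → Bool)) := by
    ext ω
    exact ⟨fun h => Finset.mem_coe.2 (Finset.mem_filter.2 ⟨Finset.mem_univ _, h⟩),
      fun h => (Finset.mem_filter.1 (Finset.mem_coe.1 h)).2⟩
  rw [hset, ← sum_measure_singleton, graphProb, ENNReal.ofReal_sum_of_nonneg
    fun ω _ => bitWeight_nonneg hp ω]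
  refine le_of_eq (Finset.sum_congr (by congr!) fun ω _ => (hsing ω).symm)

theorem law_le_one (hP : P.IsSymm) (n : ℕ) (S : Set (SimpleGraph (Vertex α n))) :
    law α P hP n S ≤ 1 := by
  have : IsProbabilityMeasure (law α P hP n) :=
    Measure.isProbabilityMeasure_map (measurable_of_finite _).aemeasurable
  exact prob_le_one

theorem tendsto_law_one (hP : P.IsSymm) (hP01 : ∀ i j, P i j ∈ Set.Ioo (0 : ℝ) 1)
    (Q : ∀ n, SimpleGraph (Vertex α n) → Prop)
    (h : Tendsto (fun n => graphProb (edgeProb α P hP n) fun G => ¬Q n G) atTop (𝓝 0)) :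
    Tendsto (fun n => law α P hP n {G | Q n G}) atTop (𝓝 1) := by
  have h1 : Tendsto (fun n => ENNReal.ofReal (1 - graphProb (edgeProb α P hP n) fun G => ¬Q n G))
      atTop (𝓝 1) := by
    have := ENNReal.tendsto_ofReal ((tendsto_const_nhds (x := (1 : ℝ))).sub h)
    simpa using this
  refine tendsto_of_tendsto_of_tendsto_of_le_of_le h1 tendsto_const_nhds (fun n => ?_)
    fun n => law_le_one hP n _
  refine le_trans (le_of_eq ?_) (ofReal_graphProb_le_law hP hP01 n (Q n))
  rw [← graphProb_add_not (p := edgeProb α P hP n) (Q n)]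
  simp

end Law

section Sizes

theorem sum_filter_lt_add (hk : 1 ≤ k) (f : Fin k → ℝ) :
    ∑ i, f i = ∑ j ∈ Finset.univ.filter (fun j : Fin k => (j : ℕ) + 1 < k), f j
      + f ⟨k - 1, by omega⟩ := by
  rw [← Finset.sum_filter_add_sum_filter_not Finset.univ (fun j : Fin k => (j : ℕ) + 1 < k)]
  congr 1
  have : Finset.univ.filter (fun j : Fin k => ¬(j : ℕ) + 1 < k) = {⟨k - 1, by omega⟩} := by
    ext j
    simp only [Finset.mem_filter, Finset.mem_univ, true_and, Finset.mem_singleton, Fin.ext_iff]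
    omega
  rw [this, Finset.sum_singleton]

theorem sum_eq_one (hα : ∀ i, α i ∈ Set.Ioc (0 : ℝ) 1) (hα1 : oneNorm α = 1) :
    ∑ i, α i = 1 := by
  rw [← hα1, oneNorm]
  exact Finset.sum_congr rfl fun i _ => (abs_of_pos (hα i).1).symm

theorem sum_floor_le (hk : 1 ≤ k) (hα : ∀ i, α i ∈ Set.Ioc (0 : ℝ) 1) (hα1 : oneNorm α = 1)
    (n : ℕ) : ∑ j ∈ Finset.univ.filter (fun j : Fin k => (j : ℕ) + 1 < k), (⌊α j * n⌋₊ : ℝ)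
      ≤ n - α ⟨k - 1, by omega⟩ * n := by
  have h := sum_filter_lt_add hk fun i => α i * n
  rw [← Finset.sum_mul, sum_eq_one hα hα1, one_mul] at h
  have : ∑ j ∈ Finset.univ.filter (fun j : Fin k => (j : ℕ) + 1 < k), (⌊α j * n⌋₊ : ℝ)
      ≤ ∑ j ∈ Finset.univ.filter (fun j : Fin k => (j : ℕ) + 1 < k), α j * n :=
    Finset.sum_le_sum fun j _ => Nat.floor_le (mul_nonneg (hα j).1.le n.cast_nonneg)
  linarith

theorem blockSize_last (hk : 1 ≤ k) (hα : ∀ i, α i ∈ Set.Ioc (0 : ℝ) 1) (hα1 : oneNorm α = 1)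
    (n : ℕ) : (blockSize α n ⟨k - 1, by omega⟩ : ℝ) =
      n - ∑ j ∈ Finset.univ.filter (fun j : Fin k => (j : ℕ) + 1 < k), (⌊α j * n⌋₊ : ℝ) := by
  have h := sum_floor_le hk hα hα1 n
  have h0 : 0 ≤ α ⟨k - 1, by omega⟩ * n := mul_nonneg (hα _).1.le n.cast_nonneg
  rw [blockSize, if_pos (by simp only; omega), Nat.cast_sub]
  · push_cast
    rfl
  · have : ((∑ j ∈ Finset.univ.filter (fun j : Fin k => (j : ℕ) + 1 < k), ⌊α j * n⌋₊ : ℕ) : ℝ)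
        ≤ n := by
      push_cast
      linarith
    exact_mod_cast this

theorem blockSize_of_lt {n : ℕ} {i : Fin k} (hi : (i : ℕ) + 1 < k) :
    blockSize α n i = ⌊α i * n⌋₊ := by
  rw [blockSize, if_neg (by omega)]

theorem sum_blockSize (hk : 1 ≤ k) (hα : ∀ i, α i ∈ Set.Ioc (0 : ℝ) 1) (hα1 : oneNorm α = 1)
    (n : ℕ) : ∑ i, (blockSize α n i : ℝ) = n := by
  rw [sum_filter_lt_add hk, blockSize_last hk hα hα1, Finset.sum_congr rfl fun i hi => by
    rw [blockSize_of_lt (Finset.mem_filter.1 hi).2]]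
  ring

theorem card_vertex (hk : 1 ≤ k) (hα : ∀ i, α i ∈ Set.Ioc (0 : ℝ) 1) (hα1 : oneNorm α = 1)
    (n : ℕ) : Fintype.card (Vertex α n) = n := by
  have := sum_blockSize hk hα hα1 n
  simp only [Fintype.card_sigma, Fintype.card_fin]
  exact_mod_cast this

theorem le_blockSize (hk : 1 ≤ k) (hα : ∀ i, α i ∈ Set.Ioc (0 : ℝ) 1) (hα1 : oneNorm α = 1)
    (n : ℕ) (i : Fin k) : α i * n - 1 ≤ blockSize α n i := by
  by_cases hi : (i : ℕ) + 1 < k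
  · rw [blockSize_of_lt hi]
    exact (Nat.sub_one_lt_floor _).le
  · have : i = ⟨k - 1, by omega⟩ := Fin.ext (by simp only; omega)
    rw [this, blockSize_last hk hα hα1]
    linarith [sum_floor_le hk hα hα1 n]

theorem blockSize_le (hk : 1 ≤ k) (hα : ∀ i, α i ∈ Set.Ioc (0 : ℝ) 1) (hα1 : oneNorm α = 1)
    (n : ℕ) (i : Fin k) : blockSize α n i ≤ α i * n + k := by
  have h1 := sum_blockSize hk hα hα1 n
  have h2 : ∑ j ∈ Finset.univ.erase i, (α j * n - 1)
      ≤ ∑ j ∈ Finset.univ.erase i, (blockSize α n j : ℝ) :=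
    Finset.sum_le_sum fun j _ => le_blockSize hk hα hα1 n j
  have h3 := Finset.add_sum_erase Finset.univ (fun j => (blockSize α n j : ℝ)) (Finset.mem_univ i)
  have h4 := Finset.add_sum_erase Finset.univ (fun j => α j * n - 1) (Finset.mem_univ i)
  have h5 : ∑ j, (α j * n - 1) = n - k := by
    rw [Finset.sum_sub_distrib, ← Finset.sum_mul, sum_eq_one hα hα1]
    simp
  linarith

theorem blockCount_univ (n : ℕ) (i : Fin k) :
    blockCount (Sigma.fst : Vertex α n → Fin k) Finset.univ i = blockSize α n i := by
  rw [blockCount, ← Fintype.card_subtype]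
  have e : {u : Vertex α n // u.1 = i} ≃ Fin (blockSize α n i) := Equiv.sigmaSubtype i
  rw [Fintype.card_congr e, Fintype.card_fin]

end Sizes

section FirstMoment

/-- With high probability there is no independent set whose type is far outside the admissible
ones. -/
theorem tendsto_graphProb_exists_large_quad (hk : 1 ≤ k) (hα : ∀ i, α i ∈ Set.Ioc (0 : ℝ) 1)
    (hα1 : oneNorm α = 1) (hP : P.IsSymm) (hP01 : ∀ i j, P i j ∈ Set.Ioo (0 : ℝ) 1) {ε : ℝ}
    (hε : 0 < ε) :
    Tendsto (fun n : ℕ => graphProb (edgeProb α P hP n) fun G =>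
      ∃ S : Finset (Vertex α n), S.Nonempty ∧ G.IsIndepSet (S : Set (Vertex α n)) ∧
        2 * ((1 + ε) * Real.log n) * S.card < quad P fun i => blockCount Sigma.fst S i)
      atTop (𝓝 0) := by
  classical
  have hlim : Tendsto (fun n : ℕ => Real.exp (Real.exp (-(ε * Real.log n) + logBound P / 2)) - 1)
      atTop (𝓝 0) := by
    have h1 : Tendsto (fun n : ℕ => -(ε * Real.log n) + logBound P / 2) atTop atBot := by
      refine tendsto_atBot_add_const_right _ _ (tendsto_neg_atTop_atBot.comp ?_)
      exact (Real.tendsto_log_atTop.comp tendsto_natCast_atTop_atTop).const_mul_atTop hε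
    have h2 := (Real.continuous_exp.tendsto 0).comp (Real.tendsto_exp_atBot.comp h1)
    simpa using h2.sub_const 1
  refine squeeze_zero' (Eventually.of_forall fun n => graphProb_nonneg
    (blockProb_mem hP hP01 Sigma.fst) _) ?_ hlim
  filter_upwards [eventually_ge_atTop 1] with n hn
  set x : ℝ := Real.exp (-((1 + ε) * Real.log n) + logBound P / 2) with hx
  set T := Finset.univ.filter fun S : Finset (Vertex α n) => S.Nonempty ∧
    2 * ((1 + ε) * Real.log n) * S.card < quad P fun i => blockCount Sigma.fst S i
  have hT : ∀ S ∈ T, graphProb (edgeProb α P hP n) (fun G => G.IsIndepSet (S : Set (Vertex α n)))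
      ≤ x ^ S.card := by
    intro S hS
    rw [graphProb_isIndepSet, edgeProb_eq_blockProb]
    refine (prod_pairs_le hP hP01 Sigma.fst S).trans ?_
    rw [hx, ← Real.exp_nat_mul]
    refine Real.exp_le_exp.2 ?_
    have := (Finset.mem_filter.1 hS).2.2
    linarith
  have hsum : ∑ S ∈ T, x ^ S.card ≤ (1 + x) ^ n - 1 := by
    have h1 := Fintype.sum_pow_mul_eq_add_pow (Vertex α n) x 1
    simp only [one_pow, mul_one, card_vertex hk hα hα1] at h1
    have h2 : ∑ S ∈ T, x ^ S.card ≤ ∑ S ∈ Finset.univ.erase (∅ : Finset (Vertex α n)), x ^ S.card :=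
      Finset.sum_le_sum_of_subset_of_nonneg (fun S hS => Finset.mem_erase.2
        ⟨(Finset.mem_filter.1 hS).2.1.ne_empty, Finset.mem_univ _⟩) fun S _ _ => by positivity
    have h3 := Finset.add_sum_erase Finset.univ (fun S : Finset (Vertex α n) => x ^ S.card)
      (Finset.mem_univ ∅)
    simp only [Finset.card_empty, pow_zero] at h3
    rw [add_comm 1 x, ← h1]
    linarith
  have hpow : (1 + x) ^ n ≤ Real.exp (Real.exp (-(ε * Real.log n) + logBound P / 2)) := by
    have h1 : (1 + x) ^ n ≤ Real.exp x ^ n :=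
      pow_le_pow_left₀ (by positivity) (by linarith [Real.add_one_le_exp x]) n
    rw [← Real.exp_nat_mul] at h1
    refine h1.trans (Real.exp_le_exp.2 (le_of_eq ?_))
    have hn' : (n : ℝ) = Real.exp (Real.log n) := (Real.exp_log (by exact_mod_cast hn)).symm
    rw [hx]
    nth_rw 1 [hn']
    rw [← Real.exp_add]
    congr 1
    ring
  calc _ ≤ graphProb (edgeProb α P hP n) fun G => ∃ S ∈ T, G.IsIndepSet (S : Set (Vertex α n)) :=
        graphProb_mono (blockProb_mem hP hP01 Sigma.fst) fun G ⟨S, h1, h2, h3⟩ =>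
          ⟨S, Finset.mem_filter.2 ⟨Finset.mem_univ _, h1, h3⟩, h2⟩
    _ ≤ _ := graphProb_exists_le (blockProb_mem hP hP01 Sigma.fst) T _
    _ ≤ _ := Finset.sum_le_sum hT
    _ ≤ _ := by linarith

theorem g_eq_restrict (c : Fin k → ℝ) (I : Finset (Fin k)) :
    g P c I = ∑ i, (if i ∈ I then c i else 0) - 1 / 2 * quad P fun i => if i ∈ I then c i else 0 := by
  rw [← g_univ, g, g]
  simp only [ite_mul, zero_mul, mul_ite, mul_zero, Finset.sum_ite_mem, Finset.univ_inter]
  congr 2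
  symm
  refine (Finset.sum_subset (Finset.subset_univ I) fun i _ hi => ?_).symm.trans
    (Finset.sum_congr rfl fun i hi => ?_)
  · simp [hi]
  · simp [hi]

theorem blockCount_filter {X : Type*} (τ : X → Fin k) (S : Finset X) (I : Finset (Fin k))
    (i : Fin k) : (blockCount τ (S.filter fun u => τ u ∈ I) i : ℝ)
      = if i ∈ I then (blockCount τ S i : ℝ) else 0 := by
  unfold blockCount
  rw [Finset.filter_filter]
  split_ifs with h
  · congr 2
    refine Finset.filter_congr fun u _ => ?_
    exact ⟨fun h => h.2, fun h' => ⟨h' ▸ h, h'⟩⟩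
  · rw [Nat.cast_eq_zero, Finset.card_eq_zero, Finset.filter_eq_empty_iff]
    rintro u _ ⟨h1, h2⟩
    exact h (h2 ▸ h1)

theorem smul_blockCount_mem_admissible {V : Type*} {τ : V → Fin k} {G : SimpleGraph V} {N : ℝ}
    (hN : 0 < N)
    (hG : ∀ S : Finset V, S.Nonempty → G.IsIndepSet (S : Set V) →
      quad P (fun i => blockCount τ S i) ≤ 2 * N * S.card)
    {S : Finset V} (hS : G.IsIndepSet (S : Set V)) :
    (1 / N) • (fun i => (blockCount τ S i : ℝ)) ∈ admissible P := by
  refine ⟨fun i => ?_, fun I _ => ?_⟩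
  · simp only [Pi.smul_apply, smul_eq_mul]
    positivity
  · set S' := S.filter fun u => τ u ∈ I
    have e : (fun i => if i ∈ I then ((1 / N) • fun i => (blockCount τ S i : ℝ)) i else 0)
        = (1 / N) • fun i => (blockCount τ S' i : ℝ) := by
      funext i
      simp only [Pi.smul_apply, S', blockCount_filter, smul_eq_mul, mul_ite, mul_zero]
    have e2 : ∑ i, (if i ∈ I then ((1 / N) • fun i => (blockCount τ S i : ℝ)) i else 0)
        = 1 / N * S'.card := by
      rw [← sum_blockCount τ S', Finset.mul_sum]
      exact Finset.sum_congr rfl fun i _ => congrFun e i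
    rw [g_eq_restrict, e2, e, quad_smul]
    rcases S'.eq_empty_or_nonempty with h | h
    · simp [h, blockCount, quad]
    · have := hG S' h (hS.mono (Finset.coe_subset.2 (Finset.filter_subset _ _)))
      have h2 : 1 / 2 * ((1 / N) ^ 2 * quad P fun i => (blockCount τ S' i : ℝ))
          ≤ 1 / 2 * ((1 / N) ^ 2 * (2 * N * S'.card)) := by gcongr
      have h3 : 1 / 2 * ((1 / N) ^ 2 * (2 * N * S'.card)) = 1 / N * S'.card := by
        field_simp
      linarith

theorem smul_blockCount_univ_mem {V : Type*} [Fintype V] {τ : V → Fin k} {G : SimpleGraph V}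
    {N : ℝ} (hN : 0 < N)
    (hG : ∀ S : Finset V, S.Nonempty → G.IsIndepSet (S : Set V) →
      quad P (fun i => blockCount τ S i) ≤ 2 * N * S.card)
    {q : ℕ} (hq : 0 < q) (hc : G.Colorable q) :
    (1 / (q * N)) • (fun i => (blockCount τ Finset.univ i : ℝ)) ∈ convexHull ℝ (admissible P) := by
  classical
  obtain ⟨C⟩ := hc
  have hmem : ∀ l : Fin q,
      (1 / N) • (fun i => (blockCount τ (Finset.univ.filter fun v => C v = l) i : ℝ))
      ∈ convexHull ℝ (admissible P) := by
    intro l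
    refine subset_convexHull ℝ _ (smul_blockCount_mem_admissible hN hG ?_)
    intro u hu v hv _ hadj
    simp only [Finset.coe_filter, Finset.mem_univ, true_and] at hu hv
    exact C.valid hadj (Eq.trans hu (Eq.symm hv))
  have hsum := (convex_convexHull ℝ (admissible P)).sum_mem (t := Finset.univ)
    (w := fun _ : Fin q => (1 / q : ℝ)) (fun _ _ => by positivity) (by simp; field_simp)
    fun l _ => hmem l
  convert hsum using 1
  funext i
  simp only [Pi.smul_apply, smul_eq_mul, Finset.sum_apply, ← Finset.mul_sum]
  have : (blockCount τ Finset.univ i : ℝ)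
      = ∑ l : Fin q, (blockCount τ (Finset.univ.filter fun v => C v = l) i : ℝ) := by
    unfold blockCount
    rw [Finset.card_eq_sum_card_fiberwise (f := C) (t := Finset.univ) (by simp)]
    push_cast
    refine Finset.sum_congr rfl fun l _ => ?_
    congr 2
    ext v
    simp [and_comm]
  rw [← this]
  field_simp

/-- The lower bound for the chromatic number. -/
theorem tendsto_graphProb_chi_lt (hk : 1 ≤ k) (hα : ∀ i, α i ∈ Set.Ioc (0 : ℝ) 1)
    (hα1 : oneNorm α = 1) (hP : P.IsSymm) (hP01 : ∀ i j, P i j ∈ Set.Ioo (0 : ℝ) 1) {ε : ℝ}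
    (hε : 0 < ε) :
    Tendsto (fun n : ℕ => graphProb (edgeProb α P hP n) fun G =>
      chi G < (1 - ε) * (n / (cStar α P * Real.log n))) atTop (𝓝 0) := by
  have hc := cStar_pos hα hα1 hP01
  have hδ : 0 < ε / 2 := by positivity
  refine squeeze_zero' (Eventually.of_forall fun n => graphProb_nonneg
    (blockProb_mem hP hP01 Sigma.fst) _) ?_
    (tendsto_graphProb_exists_large_quad hk hα hα1 hP hP01 hδ)
  have hsize : ∀ᶠ n : ℕ in atTop, ∀ i, (1 - ε / 2) * (α i * n) ≤ blockSize α n i := by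
    rw [eventually_all]
    intro i
    have h := (tendsto_natCast_atTop_atTop (R := ℝ)).const_mul_atTop
      (mul_pos hδ (hα i).1)
    filter_upwards [h.eventually_ge_atTop 1] with n hn
    have := le_blockSize hk hα hα1 n i
    linarith
  filter_upwards [hsize, eventually_ge_atTop 2] with n hn hn2
  refine graphProb_mono (blockProb_mem hP hP01 Sigma.fst) fun G hG => ?_
  by_contra! hno
  refine absurd hG (not_lt.2 ?_)
  have hlog : 0 < Real.log n := Real.log_pos (by exact_mod_cast hn2)
  have hcol : G.Colorable G.chromaticNumber.toNat := G.colorable_chromaticNumber_of_fintype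
  set q := G.chromaticNumber.toNat with hq
  have hcard := card_vertex hk hα hα1 n
  have hq0 : 0 < q := by
    rcases Nat.eq_zero_or_pos q with h | h
    · obtain ⟨C⟩ := hcol
      have : Nonempty (Vertex α n) := Fintype.card_pos_iff.1 (by omega)
      exact absurd (C this.some).2 (by omega)
    · exact h
  have hmem := smul_blockCount_univ_mem (P := P) (τ := (Sigma.fst : Vertex α n → Fin k))
    (N := (1 + ε / 2) * Real.log n) (by positivity) hno hq0 hcol
  simp only [blockCount_univ] at hmem
  have hchi : chi G = q := rfl
  rw [hchi]
  rcases le_total (1 - ε / 2) 0 with hneg | hpos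
  · have : (1 - ε) * (n / (cStar α P * Real.log n)) ≤ 0 :=
      mul_nonpos_of_nonpos_of_nonneg (by linarith) (by positivity)
    exact this.trans q.cast_nonneg
  set t : ℝ := (1 - ε / 2) * n / (q * ((1 + ε / 2) * Real.log n)) with ht
  have ht0 : 0 ≤ t := by positivity
  have hle : t ≤ cStar α P := by
    refine le_cStar hα1 hP01 ht0 (convexHull_admissible_of_le hP01 hmem (fun i => ?_) fun i => ?_)
    · have := (hα i).1
      simp only [Pi.smul_apply, smul_eq_mul]
      positivity
    · simp only [Pi.smul_apply, smul_eq_mul, ht]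
      rw [div_mul_eq_mul_div, one_div, inv_mul_eq_div]
      refine div_le_div_of_nonneg_right ?_ (by positivity)
      linarith [hn i]
  have hq' : (0 : ℝ) < q := by exact_mod_cast hq0
  rw [ht, div_le_iff₀ (by positivity)] at hle
  rw [mul_div_assoc', div_le_iff₀ (by positivity)]
  have h1 : (1 - ε) * n * (1 + ε / 2) ≤ (1 - ε / 2) * n := by
    have : (0 : ℝ) ≤ n := n.cast_nonneg
    nlinarith [mul_nonneg (sq_nonneg ε) this]
  have h2 : (1 - ε) * n * (1 + ε / 2) ≤ (q * (cStar α P * Real.log n)) * (1 + ε / 2) := by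
    linarith
  exact le_of_mul_le_mul_right h2 (by positivity)

end FirstMoment

section Transversals

theorem pairs_inter {X : Type*} [DecidableEq X] (S T : Finset X) :
    pairs S ∩ pairs T = pairs (S ∩ T) := by
  ext e
  induction e with
  | _ u v =>
    simp only [Finset.mem_inter, mk_mem_pairs]
    tauto

variable {K V : Type*} {r : ℕ}

theorem injective_select {φ : K × Fin r → V} (hφ : φ.Injective) (f : K → Fin r) :
    Function.Injective fun κ => φ (κ, f κ) :=
  fun _ _ h => congrArg Prod.fst (hφ h)

variable [DecidableEq V]

/-- The transversal of the cells `φ (κ, ·)` that `f` selects. -/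
def transversal (φ : K × Fin r → V) (f : K → Fin r) (D : Finset K) : Finset V :=
  D.image fun κ => φ (κ, f κ)

theorem blockCount_transversal {φ : K × Fin r → V} (hφ : φ.Injective) {β : V → Fin k}
    {τ : K → Fin k} (hβ : ∀ x, β (φ x) = τ x.1) (f : K → Fin r) (D : Finset K) (i : Fin k) :
    blockCount β (transversal φ f D) i = blockCount τ D i := by
  unfold blockCount transversal
  rw [Finset.filter_image, Finset.card_image_of_injective _ (injective_select hφ f)]
  simp only [hβ]

theorem prod_pairs_transversal [DecidableEq K] (hP : P.IsSymm)
    (hP01 : ∀ i j, P i j ∈ Set.Ioo (0 : ℝ) 1)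
    {φ : K × Fin r → V} (hφ : φ.Injective) {β : V → Fin k} {τ : K → Fin k}
    (hβ : ∀ x, β (φ x) = τ x.1) (f : K → Fin r) (D : Finset K) :
    ∏ e ∈ pairs (transversal φ f D), (1 - blockProb hP β e)
      = ∏ e ∈ pairs D, (1 - blockProb hP τ e) := by
  rw [prod_pairs_eq_exp hP hP01, prod_pairs_eq_exp hP hP01]
  simp only [blockCount_transversal hφ hβ]
  congr 3
  rw [transversal, Finset.sum_image fun _ _ _ _ h => injective_select hφ f h]
  simp only [hβ]

variable [Fintype K]

theorem transversal_inter {φ : K × Fin r → V} (hφ : φ.Injective) (f f' : K → Fin r) :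
    transversal φ f Finset.univ ∩ transversal φ f' Finset.univ
      = transversal φ f (Finset.univ.filter fun κ => f' κ = f κ) := by
  ext v
  simp only [transversal, Finset.mem_inter, Finset.mem_image, Finset.mem_univ, true_and,
    Finset.mem_filter]
  constructor
  · rintro ⟨⟨κ, rfl⟩, κ', h⟩
    have := hφ h
    simp only [Prod.mk.injEq] at this
    obtain ⟨rfl, h2⟩ := this
    exact ⟨κ', h2, rfl⟩
  · rintro ⟨κ, h, rfl⟩
    exact ⟨⟨κ, rfl⟩, κ, by rw [h]⟩

variable [DecidableEq K]

theorem card_filter_agree (f : K → Fin r) (D : Finset K) :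
    (Finset.univ.filter fun f' : K → Fin r => ∀ κ ∈ D, f' κ = f κ).card
      = r ^ (Fintype.card K - D.card) := by
  have : (Finset.univ.filter fun f' : K → Fin r => ∀ κ ∈ D, f' κ = f κ)
      = Fintype.piFinset fun κ => if κ ∈ D then {f κ} else Finset.univ := by
    ext f'
    simp only [Finset.mem_filter, Finset.mem_univ, true_and, Fintype.mem_piFinset]
    refine forall_congr' fun κ => ?_
    split_ifs with h <;> simp [h]
  rw [this, Fintype.card_piFinset]
  have h2 : ∀ κ, (if κ ∈ D then {f κ} else Finset.univ : Finset (Fin r)).card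
      = if κ ∈ D then 1 else r := fun κ => by split_ifs <;> simp
  simp only [h2]
  rw [Finset.prod_ite, Finset.prod_const_one, one_mul, Finset.prod_const]
  congr 1
  rw [← Finset.card_compl]
  congr 1
  ext κ
  simp

variable [Fintype V]

/-- The probability that no transversal of given cells is independent. -/
theorem graphProb_no_transversal_le (hP : P.IsSymm) (hP01 : ∀ i j, P i j ∈ Set.Ioo (0 : ℝ) 1)
    (hr : 0 < r) {φ : K × Fin r → V} (hφ : φ.Injective) {β : V → Fin k} {τ : K → Fin k}
    (hβ : ∀ x, β (φ x) = τ x.1) {R : ℝ} (hR0 : 0 < R)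
    (hR : ∑ D : Finset K with 2 ≤ D.card,
      Real.exp (1 / 2 * quad P fun i => blockCount τ D i) / (r : ℝ) ^ D.card ≤ R) :
    graphProb (blockProb hP β)
      (fun G => ∀ f, ¬G.IsIndepSet (transversal φ f Finset.univ : Set V))
      ≤ Real.exp (-(1 / (2 * R))) := by
  have hr' : (0 : ℝ) < r := by exact_mod_cast hr
  have hp := blockProb_mem hP hP01 β
  set F : (K → Fin r) → Finset (Sym2 V) := fun f => pairs (transversal φ f Finset.univ) with hF
  set π := ∏ e ∈ pairs (Finset.univ : Finset K), (1 - blockProb hP τ e) with hπ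
  have hπ0 : 0 < π := Finset.prod_pos fun e _ => by linarith [(blockProb_mem hP hP01 τ e).2]
  have hFπ : ∀ f, ∏ e ∈ F f, (1 - blockProb hP β e) = π := fun f =>
    prod_pairs_transversal hP hP01 hφ hβ f _
  set W : Finset K → ℝ := fun D => Real.exp (1 / 2 * quad P fun i => blockCount τ D i) with hW
  have hunion : ∀ f f', ∏ e ∈ F f ∪ F f', (1 - blockProb hP β e)
      ≤ π ^ 2 * W (Finset.univ.filter fun κ => f' κ = f κ) := by
    intro f f'
    have h1 := Finset.prod_union_inter (s₁ := F f) (s₂ := F f')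
      (f := fun e => 1 - blockProb hP β e)
    rw [hFπ, hFπ, hF, pairs_inter, transversal_inter hφ,
      prod_pairs_transversal hP hP01 hφ hβ] at h1
    have h2 := le_prod_pairs hP hP01 τ (Finset.univ.filter fun κ => f' κ = f κ)
    have h3 : 0 ≤ ∏ e ∈ F f ∪ F f', (1 - blockProb hP β e) :=
      Finset.prod_nonneg fun e _ => by linarith [(hp e).2]
    have h4 := mul_le_mul_of_nonneg_left h2 h3
    rw [h1, Real.exp_neg, ← div_eq_mul_inv, div_le_iff₀ (Real.exp_pos _)] at h4
    rw [pow_two]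
    exact h4
  have hcard2 : ∀ f f', ¬Disjoint (F f) (F f') →
      2 ≤ (Finset.univ.filter fun κ => f' κ = f κ).card := by
    intro f f' h
    rw [Finset.not_disjoint_iff_nonempty_inter, hF, pairs_inter, transversal_inter hφ] at h
    obtain ⟨e, he⟩ := h
    induction e with
    | _ u v =>
      rw [mk_mem_pairs] at he
      have := Finset.one_lt_card.2 ⟨u, he.1, v, he.2.1, he.2.2⟩
      rwa [transversal, Finset.card_image_of_injective _ (injective_select hφ f)] at this
  have hrow : ∀ f, ∑ f' with ¬Disjoint (F f) (F f'), ∏ e ∈ F f ∪ F f', (1 - blockProb hP β e)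
      ≤ π ^ 2 * (r : ℝ) ^ Fintype.card K * R := by
    intro f
    calc _ ≤ ∑ f' : K → Fin r with ¬Disjoint (F f) (F f'),
          π ^ 2 * W (Finset.univ.filter fun κ => f' κ = f κ) :=
          Finset.sum_le_sum fun f' _ => hunion f f'
      _ ≤ ∑ f' : K → Fin r with ¬Disjoint (F f) (F f'),
          ∑ D : Finset K with 2 ≤ D.card, if ∀ κ ∈ D, f' κ = f κ then π ^ 2 * W D else 0 := by
          refine Finset.sum_le_sum fun f' hf' => ?_
          have hD := hcard2 f f' (Finset.mem_filter.1 hf').2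
          have h0 : ∀ D ∈ Finset.univ.filter (fun D : Finset K => 2 ≤ D.card),
              0 ≤ if ∀ κ ∈ D, f' κ = f κ then π ^ 2 * W D else 0 := fun D _ => by
            split_ifs
            · exact mul_nonneg (sq_nonneg _) (Real.exp_pos _).le
            · exact le_rfl
          refine le_trans ?_ (Finset.single_le_sum h0
            (Finset.mem_filter.2 ⟨Finset.mem_univ _, hD⟩))
          rw [if_pos]
          simp
      _ ≤ ∑ f' : K → Fin r, ∑ D : Finset K with 2 ≤ D.card,
          if ∀ κ ∈ D, f' κ = f κ then π ^ 2 * W D else 0 := by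
          refine Finset.sum_le_sum_of_subset_of_nonneg (Finset.filter_subset _ _) fun f' _ _ =>
            Finset.sum_nonneg fun D _ => ?_
          split_ifs
          · exact mul_nonneg (sq_nonneg _) (Real.exp_pos _).le
          · exact le_rfl
      _ = ∑ D : Finset K with 2 ≤ D.card, π ^ 2 * (r : ℝ) ^ Fintype.card K *
          (W D / (r : ℝ) ^ D.card) := by
          rw [Finset.sum_comm]
          refine Finset.sum_congr rfl fun D _ => ?_
          rw [← Finset.sum_filter, Finset.sum_const, card_filter_agree, nsmul_eq_mul, Nat.cast_pow,
            pow_sub₀ _ hr'.ne' (Finset.card_le_univ D)]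
          field_simp
      _ ≤ _ := by
          rw [← Finset.mul_sum]
          exact mul_le_mul_of_nonneg_left hR (by positivity)
  have hJ := janson hp F (Δ := (r : ℝ) ^ Fintype.card K * (π ^ 2 * (r : ℝ) ^ Fintype.card K * R))
    (by positivity) (by
      refine (Finset.sum_le_sum fun f _ => hrow f).trans (le_of_eq ?_)
      rw [Finset.sum_const, nsmul_eq_mul]
      simp)
  have hexp : (∑ f, ∏ e ∈ F f, (1 - blockProb hP β e)) ^ 2 /
      (2 * ((r : ℝ) ^ Fintype.card K * (π ^ 2 * (r : ℝ) ^ Fintype.card K * R))) = 1 / (2 * R) := by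
    simp only [hFπ, Finset.sum_const, nsmul_eq_mul, Finset.card_univ, Fintype.card_pi,
      Fintype.card_fin, Finset.prod_const, Nat.cast_pow]
    field_simp
  rw [hexp] at hJ
  refine le_trans (le_of_eq ?_) hJ
  unfold graphProb
  refine Finset.sum_congr ?_ fun _ _ => rfl
  ext ω
  simp only [Finset.mem_filter, Finset.mem_univ, true_and]
  refine forall_congr' fun f => ?_
  rw [graphOf_isIndepSet_iff, offInd]
  simp [hF]

end Transversals

section Estimate

theorem half_quad_le (hP01 : ∀ i j, P i j ∈ Set.Ioo (0 : ℝ) 1) {a t : Fin k → ℝ}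
    (ha : a ∈ admissible P) {N : ℝ} (hN : 0 < N) (ht0 : ∀ i, 0 ≤ t i)
    (ht : ∀ i, t i ≤ N * a i) : 1 / 2 * quad P t ≤ N * ∑ i, t i := by
  have hmem : (1 / N) • t ∈ admissible P := by
    refine admissible_of_le hP01 ha (fun i => ?_) fun i => ?_
    · have := ht0 i
      simp only [Pi.smul_apply, smul_eq_mul]
      positivity
    · simp only [Pi.smul_apply, smul_eq_mul]
      rw [one_div, inv_mul_le_iff₀ hN]
      exact ht i
  have h := g_nonneg_of_mem hmem Finset.univ
  rw [g_univ, quad_smul] at h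
  simp only [Pi.smul_apply, smul_eq_mul, ← Finset.mul_sum] at h
  have h2 := mul_nonneg (sq_nonneg N) h
  have e : N ^ 2 * (1 / N * ∑ i, t i - 1 / 2 * ((1 / N) ^ 2 * quad P t))
      = N * ∑ i, t i - 1 / 2 * quad P t := by field_simp
  linarith

theorem sum_exp_quad_div_le (hP01 : ∀ i j, P i j ∈ Set.Ioo (0 : ℝ) 1) {a : Fin k → ℝ}
    (ha : a ∈ admissible P) {η L : ℝ} (hη : 0 < η) (hη2 : η ≤ 1 / 2) (hL : 0 < L)
    {K : Type*} [Fintype K] [DecidableEq K] {τ : K → Fin k}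
    (hK : ∀ i, (blockCount τ Finset.univ i : ℝ) ≤ (1 - η) * L * a i)
    (hcard : (Fintype.card K : ℝ) ≤ Real.exp (η * L / 4)) {r : ℕ}
    (hr : Real.exp ((1 - η / 8) * L) ≤ r) :
    ∑ D : Finset K with 2 ≤ D.card,
      Real.exp (1 / 2 * quad P fun i => blockCount τ D i) / (r : ℝ) ^ D.card
      ≤ Real.exp (logBound P / 2 * (6 / η) ^ 2 + 1 - 3 / 2 * L) := by
  set M := logBound P
  have hM : 0 < M := logBound_pos
  have hr0 : (0 : ℝ) < r := (Real.exp_pos _).trans_le hr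
  have hterm : ∀ D ∈ Finset.univ.filter (fun D : Finset K => 2 ≤ D.card),
      Real.exp (1 / 2 * quad P fun i => blockCount τ D i) / (r : ℝ) ^ D.card
      ≤ Real.exp (M / 2 * (6 / η) ^ 2 - 3 / 2 * L) * Real.exp (-(η * L / 4)) ^ D.card := by
    intro D hD
    have hd2 : (2 : ℝ) ≤ D.card := by exact_mod_cast (Finset.mem_filter.1 hD).2
    set d : ℝ := (D.card : ℝ) with hd
    have hrd : Real.exp (d * ((1 - η / 8) * L)) ≤ (r : ℝ) ^ D.card := by
      rw [Real.exp_nat_mul]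
      exact pow_le_pow_left₀ (Real.exp_pos _).le hr _
    have hq1 : 1 / 2 * (quad P fun i => (blockCount τ D i : ℝ)) ≤ M / 2 * d ^ 2 := by
      have := quad_le (P := P) (t := fun i => (blockCount τ D i : ℝ)) fun i => Nat.cast_nonneg _
      rw [sum_blockCount] at this
      linarith
    have hq2 : 1 / 2 * (quad P fun i => (blockCount τ D i : ℝ)) ≤ (1 - η) * L * d := by
      rw [hd, ← sum_blockCount τ D]
      refine half_quad_le hP01 ha (mul_pos (by linarith) hL) (fun i => Nat.cast_nonneg _)
        fun i => le_trans ?_ (hK i)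
      exact_mod_cast Finset.card_le_card (Finset.filter_subset_filter _ (Finset.subset_univ D))
    rw [div_le_iff₀ (pow_pos hr0 _), ← Real.exp_nat_mul, ← Real.exp_add]
    refine le_trans ?_ (mul_le_mul_of_nonneg_left hrd (Real.exp_pos _).le)
    rw [← Real.exp_add]
    refine Real.exp_le_exp.2 ?_
    rw [← hd]
    rcases le_or_gt d (6 / η) with h | h
    · have h1 : M / 2 * d ^ 2 ≤ M / 2 * (6 / η) ^ 2 := by gcongr
      have h2 : 3 / 2 * L ≤ d * (1 - 3 * η / 8) * L := by
        refine mul_le_mul_of_nonneg_right ?_ hL.le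
        nlinarith
      linarith
    · rw [div_lt_iff₀ hη] at h
      have h1 : 0 ≤ M / 2 * (6 / η) ^ 2 := by positivity
      have h2 : 3 / 2 * L ≤ 5 / 8 * (d * η) * L := by
        refine mul_le_mul_of_nonneg_right ?_ hL.le
        linarith
      linarith
  calc _ ≤ ∑ D : Finset K with 2 ≤ D.card,
        Real.exp (M / 2 * (6 / η) ^ 2 - 3 / 2 * L) * Real.exp (-(η * L / 4)) ^ D.card :=
        Finset.sum_le_sum hterm
    _ ≤ ∑ D : Finset K,
        Real.exp (M / 2 * (6 / η) ^ 2 - 3 / 2 * L) * Real.exp (-(η * L / 4)) ^ D.card :=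
        Finset.sum_le_sum_of_subset_of_nonneg (Finset.filter_subset _ _) fun D _ _ => by positivity
    _ = Real.exp (M / 2 * (6 / η) ^ 2 - 3 / 2 * L)
        * (Real.exp (-(η * L / 4)) + 1) ^ Fintype.card K := by
        rw [← Finset.mul_sum]
        have := Fintype.sum_pow_mul_eq_add_pow K (Real.exp (-(η * L / 4))) 1
        simp only [one_pow, mul_one] at this
        rw [this]
    _ ≤ Real.exp (M / 2 * (6 / η) ^ 2 - 3 / 2 * L) * Real.exp 1 := by
        refine mul_le_mul_of_nonneg_left ?_ (Real.exp_pos _).le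
        calc _ ≤ Real.exp (Real.exp (-(η * L / 4))) ^ Fintype.card K :=
              pow_le_pow_left₀ (by positivity) (Real.add_one_le_exp _) _
          _ ≤ _ := by
              rw [← Real.exp_nat_mul]
              refine Real.exp_le_exp.2 ?_
              rw [Real.exp_neg, ← div_eq_mul_inv]
              exact (div_le_one (Real.exp_pos _)).2 hcard
    _ = _ := by
        rw [← Real.exp_add]
        congr 1
        ring

end Estimate

section Extraction

/-- The number of vertices in the `i`-th part of the independent sets of type `(1 - η) a`. -/
noncomputable def typeSize (η : ℝ) (a : Fin k → ℝ) (n : ℕ) (i : Fin k) : ℕ :=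
  ⌊(1 - η) * Real.log n * a i⌋₊

/-- The number of vertices in each cell. -/
noncomputable def cellSize (n : ℕ) : ℕ := ⌊(n : ℝ) / Real.log n ^ 4⌋₊

theorem exists_cells {V : Type*} {β : V → Fin k} {s : Fin k → ℕ}
    {r : ℕ} {U : Finset V} (hU : ∀ i, s i * r ≤ blockCount β U i) :
    ∃ φ : ((i : Fin k) × Fin (s i)) × Fin r → V,
      φ.Injective ∧ (∀ x, β (φ x) = x.1.1) ∧ ∀ x, φ x ∈ U := by
  have hemb : ∀ i, Nonempty (Fin (s i) × Fin r ↪ {u // u ∈ U.filter fun u => β u = i}) := by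
    intro i
    refine Function.Embedding.nonempty_of_card_le ?_
    rw [Fintype.card_prod, Fintype.card_fin, Fintype.card_fin, Fintype.card_coe]
    exact hU i
  have e := fun i => (hemb i).some
  have hmem : ∀ i y, ((e i y : V) ∈ U) ∧ β (e i y) = i := fun i y =>
    Finset.mem_filter.1 (e i y).2
  refine ⟨fun x => e x.1.1 (x.1.2, x.2), ?_, fun x => (hmem _ _).2, fun x => (hmem _ _).1⟩
  rintro ⟨⟨i, x⟩, y⟩ ⟨⟨j, x'⟩, y'⟩ h
  have hij : i = j := by
    have := congrArg β h
    simpa only [(hmem _ _).2] using this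
  subst hij
  have := (e i).injective (Subtype.ext h)
  simp only [Prod.mk.injEq] at this
  obtain ⟨rfl, rfl⟩ := this
  rfl

theorem tendsto_log_natCast : Tendsto (fun n : ℕ => Real.log n) atTop atTop :=
  Real.tendsto_log_atTop.comp tendsto_natCast_atTop_atTop

theorem eventually_mul_pow_le_exp (C : ℝ) (m : ℕ) {b : ℝ} (hb : 0 < b) :
    ∀ᶠ n : ℕ in atTop, C * Real.log n ^ m ≤ Real.exp (b * Real.log n) := by
  have h : (fun x : ℝ => C * x ^ m) =o[atTop] fun x => Real.exp (b * x) :=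
    (isLittleO_pow_exp_pos_mul_atTop m hb).const_mul_left C
  filter_upwards [tendsto_log_natCast.eventually (h.bound one_pos)] with n hn
  rw [one_mul, Real.norm_of_nonneg (Real.exp_pos _).le] at hn
  exact (le_abs_self _).trans hn

theorem eventually_le_cellSize {η : ℝ} (hη : 0 < η) :
    ∀ᶠ n : ℕ in atTop, Real.exp ((1 - η / 8) * Real.log n) ≤ cellSize n := by
  filter_upwards [eventually_mul_pow_le_exp 2 4 (b := η / 8) (by positivity),
    eventually_mul_pow_le_exp 2 4 (b := 1) one_pos, eventually_ge_atTop 2] with n h1 h2 hn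
  have hlog : 0 < Real.log n := Real.log_pos (by exact_mod_cast hn)
  have hn' : (n : ℝ) = Real.exp (Real.log n) := (Real.exp_log (by positivity)).symm
  set L := Real.log n
  have h3 : 2 ≤ (n : ℝ) / L ^ 4 := by
    rw [le_div_iff₀ (by positivity), hn']
    simpa using h2
  have h4 : 2 * Real.exp ((1 - η / 8) * L) ≤ (n : ℝ) / L ^ 4 := by
    rw [le_div_iff₀ (by positivity)]
    calc _ = Real.exp ((1 - η / 8) * L) * (2 * L ^ 4) := by ring
      _ ≤ Real.exp ((1 - η / 8) * L) * Real.exp (η / 8 * L) := by gcongr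
      _ = n := by
        rw [hn', ← Real.exp_add]
        congr 1
        ring
  have h5 := Nat.sub_one_lt_floor ((n : ℝ) / L ^ 4)
  change _ ≤ ((⌊(n : ℝ) / L ^ 4⌋₊ : ℕ) : ℝ)
  linarith

theorem typeSize_le {η : ℝ} (hη : η ≤ 1) {a : Fin k → ℝ} (ha : ∀ i, 0 ≤ a i) {n : ℕ} (i : Fin k) :
    (typeSize η a n i : ℝ) ≤ (1 - η) * Real.log n * a i :=
  Nat.floor_le (mul_nonneg (mul_nonneg (sub_nonneg.2 hη) (Real.log_natCast_nonneg n)) (ha i))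

theorem typeSize_mul_cellSize_le {η : ℝ} (hη0 : 0 ≤ η) (hη : η ≤ 1) {a : Fin k → ℝ}
    (ha : ∀ i, 0 ≤ a i) {n : ℕ} (hn : 2 ≤ n) (i : Fin k) :
    (typeSize η a n i * cellSize n : ℝ) ≤ a i * (n / Real.log n ^ 3) := by
  have hlog : 0 < Real.log n := Real.log_pos (by exact_mod_cast hn)
  have h1 : (typeSize η a n i : ℝ) ≤ Real.log n * a i := (typeSize_le hη ha i).trans (by
    rw [mul_assoc]
    exact mul_le_of_le_one_left (mul_nonneg hlog.le (ha i)) (by linarith))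
  have h2 : (cellSize n : ℝ) ≤ n / Real.log n ^ 4 := Nat.floor_le (by positivity)
  have := ha i
  calc _ ≤ Real.log n * a i * (n / Real.log n ^ 4) := by gcongr
    _ = _ := by field_simp

/-- With high probability, every set with not too few vertices in each part contains independent
sets of nearly admissible types. -/
theorem tendsto_graphProb_no_extraction (hk : 1 ≤ k) (hα : ∀ i, α i ∈ Set.Ioc (0 : ℝ) 1)
    (hα1 : oneNorm α = 1) (hP : P.IsSymm) (hP01 : ∀ i j, P i j ∈ Set.Ioo (0 : ℝ) 1)
    {a : Fin k → ℝ} (ha : a ∈ admissible P) {η : ℝ} (hη : 0 < η) (hη2 : η ≤ 1 / 2) :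
    Tendsto (fun n : ℕ => graphProb (edgeProb α P hP n) fun G =>
      ¬∀ U : Finset (Vertex α n),
        (∀ i, typeSize η a n i * cellSize n ≤ blockCount Sigma.fst U i) →
        ∃ S ⊆ U, G.IsIndepSet (S : Set (Vertex α n)) ∧
          ∀ i, blockCount Sigma.fst S i = typeSize η a n i) atTop (𝓝 0) := by
  classical
  set B : ℝ := logBound P / 2 * (6 / η) ^ 2 + 1 with hB
  have hlim : Tendsto (fun n : ℕ => Real.exp (Real.exp (Real.log n) *
      (Real.log n - 1 / 2 * Real.exp (-B) * Real.exp (Real.log n / 2)))) atTop (𝓝 0) := by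
    refine Real.tendsto_exp_atBot.comp (Tendsto.comp (g := fun x : ℝ =>
      Real.exp x * (x - 1 / 2 * Real.exp (-B) * Real.exp (x / 2))) ?_ tendsto_log_natCast)
    refine Real.tendsto_exp_atTop.atTop_mul_atBot₀ ?_
    have h1 : (fun x : ℝ => x) =o[atTop] fun x => Real.exp (1 / 2 * x) := by
      simpa using isLittleO_pow_exp_pos_mul_atTop 1 (b := 1 / 2) (by norm_num)
    have hc : 0 < 1 / 4 * Real.exp (-B) := by positivity
    have h2 : Tendsto (fun x : ℝ => -(1 / 4 * Real.exp (-B) * Real.exp (1 / 2 * x))) atTop atBot := by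
      refine tendsto_neg_atTop_atBot.comp (Tendsto.const_mul_atTop hc ?_)
      exact Real.tendsto_exp_atTop.comp (tendsto_id.const_mul_atTop (by norm_num))
    refine tendsto_atBot_mono' _ ?_ h2
    filter_upwards [h1.bound hc] with x hx
    rw [Real.norm_of_nonneg (Real.exp_pos _).le] at hx
    have := (le_abs_self x).trans hx
    rw [show x / 2 = 1 / 2 * x by ring]
    linarith
  refine squeeze_zero' (Eventually.of_forall fun n => graphProb_nonneg
    (blockProb_mem hP hP01 Sigma.fst) _) ?_ hlim
  have ha0 := ha.1
  filter_upwards [eventually_le_cellSize hη,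
    eventually_mul_pow_le_exp (∑ i, a i) 1 (b := η / 4) (by positivity), eventually_ge_atTop 2,
    tendsto_log_natCast.eventually_ge_atTop 1, tendsto_log_natCast.eventually_ge_atTop (∑ i, a i)]
    with n hr hA hn hlog1 hlogA
  have hlog : 0 < Real.log n := by linarith
  have hn0 : (0 : ℝ) < n := by positivity
  set L := Real.log n with hL
  set r := cellSize n with hrdef
  have hr0 : 0 < r := by
    have := (Real.exp_pos _).trans_le hr
    exact_mod_cast this
  set K := (i : Fin k) × Fin (typeSize η a n i) with hK
  have hKcard : (Fintype.card K : ℝ) = ∑ i, (typeSize η a n i : ℝ) := by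
    simp [hK, Fintype.card_sigma]
  have hKle : (Fintype.card K : ℝ) ≤ Real.exp (η * L / 4) := by
    rw [hKcard]
    calc _ ≤ ∑ i, L * a i := Finset.sum_le_sum fun i _ => (typeSize_le (by linarith) ha0 i).trans (by
            rw [mul_assoc]
            exact mul_le_of_le_one_left (mul_nonneg hlog.le (ha0 i)) (by linarith))
      _ = (∑ i, a i) * L ^ 1 := by rw [← Finset.mul_sum]; ring
      _ ≤ _ := hA
      _ = _ := by congr 1; ring
  have hKr : (Fintype.card K * r : ℝ) ≤ n := by
    rw [hKcard, Finset.sum_mul]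
    calc _ ≤ ∑ i, a i * (n / L ^ 3) := Finset.sum_le_sum fun i _ =>
            typeSize_mul_cellSize_le hη.le (by linarith) ha0 hn i
      _ = (∑ i, a i) * (n / L ^ 3) := by rw [Finset.sum_mul]
      _ ≤ L * (n / L ^ 3) := by gcongr
      _ = n / L ^ 2 := by field_simp
      _ ≤ n := div_le_self hn0.le (one_le_pow₀ hlog1)
  have hR := sum_exp_quad_div_le hP01 ha hη hη2 hlog (K := K) (τ := Sigma.fst) (fun i => by
      have : blockCount (Sigma.fst : K → Fin k) Finset.univ i = typeSize η a n i := by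
        rw [blockCount, ← Fintype.card_subtype]
        have e : {u : K // u.1 = i} ≃ Fin (typeSize η a n i) := Equiv.sigmaSubtype i
        rw [Fintype.card_congr e, Fintype.card_fin]
      rw [this]
      exact typeSize_le (by linarith) ha0 i) hKle hr
  set T := Finset.univ.filter fun φ : K × Fin r → Vertex α n =>
    φ.Injective ∧ ∀ x, (φ x).1 = x.1.1
  have hcount : (T.card : ℝ) ≤ Real.exp (n * L) := by
    have h1 : T.card ≤ n ^ (Fintype.card K * r) := by
      refine (Finset.card_le_univ T).trans (le_of_eq ?_)
      rw [Fintype.card_fun, card_vertex hk hα hα1, Fintype.card_prod, Fintype.card_fin]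
    calc (T.card : ℝ) ≤ (n : ℝ) ^ (Fintype.card K * r) := by exact_mod_cast h1
      _ = Real.exp ((Fintype.card K * r : ℝ) * L) := by
        rw [← Nat.cast_mul, Real.exp_nat_mul, hL, Real.exp_log hn0]
      _ ≤ _ := Real.exp_le_exp.2 (mul_le_mul_of_nonneg_right hKr hlog.le)
  calc _ ≤ graphProb (edgeProb α P hP n) fun G => ∃ φ ∈ T, ∀ f,
          ¬G.IsIndepSet (transversal φ f Finset.univ : Set (Vertex α n)) := by
        refine graphProb_mono (blockProb_mem hP hP01 Sigma.fst) fun G hG => ?_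
        by_contra! hno
        refine hG fun U hU => ?_
        obtain ⟨φ, hφ, hβ, hφU⟩ := exists_cells hU
        obtain ⟨f, hf⟩ := hno φ (Finset.mem_filter.2 ⟨Finset.mem_univ _, hφ, hβ⟩)
        refine ⟨_, ?_, hf, fun i => ?_⟩
        · intro v hv
          obtain ⟨κ, -, rfl⟩ := Finset.mem_image.1 hv
          exact hφU _
        · rw [blockCount_transversal hφ (τ := Sigma.fst) hβ, blockCount, ← Fintype.card_subtype]
          have e : {u : K // u.1 = i} ≃ Fin (typeSize η a n i) := Equiv.sigmaSubtype i
          rw [Fintype.card_congr e, Fintype.card_fin]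
    _ ≤ ∑ φ ∈ T, graphProb (edgeProb α P hP n) fun G => ∀ f,
          ¬G.IsIndepSet (transversal φ f Finset.univ : Set (Vertex α n)) :=
        graphProb_exists_le (blockProb_mem hP hP01 Sigma.fst) T _
    _ ≤ ∑ φ ∈ T, Real.exp (-(1 / (2 * Real.exp (B - 3 / 2 * L)))) := by
        refine Finset.sum_le_sum fun φ hφ => ?_
        have := (Finset.mem_filter.1 hφ).2
        exact graphProb_no_transversal_le hP hP01 hr0 this.1 (τ := Sigma.fst) this.2
          (Real.exp_pos _) hR
    _ ≤ Real.exp (n * L) * Real.exp (-(1 / (2 * Real.exp (B - 3 / 2 * L)))) := by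
        rw [Finset.sum_const, nsmul_eq_mul]
        exact mul_le_mul_of_nonneg_right hcount (Real.exp_pos _).le
    _ = _ := by
        rw [← Real.exp_add]
        congr 1
        have h1 : 1 / (2 * Real.exp (B - 3 / 2 * L))
            = 1 / 2 * Real.exp (-B) * Real.exp (L / 2) * Real.exp L := by
          rw [mul_assoc, mul_assoc, ← Real.exp_add, ← Real.exp_add, one_div, mul_inv,
            ← Real.exp_neg]
          congr 2
          · norm_num
          · ring
        rw [h1, hL, Real.exp_log hn0]
        ring

end Extraction

section Greedy

theorem blockCount_mono {V : Type*} {β : V → Fin k} {S U : Finset V} (h : S ⊆ U) (i : Fin k) :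
    blockCount β S i ≤ blockCount β U i :=
  Finset.card_le_card (Finset.filter_subset_filter _ h)

variable {V : Type*} [DecidableEq V] {β : V → Fin k} {G : SimpleGraph V}

theorem blockCount_sdiff_add {S U : Finset V} (h : S ⊆ U) (i : Fin k) :
    blockCount β (U \ S) i + blockCount β S i = blockCount β U i := by
  unfold blockCount
  rw [← Finset.card_sdiff_add_card_eq_card (Finset.filter_subset_filter _ h)]
  congr 2
  ext v
  simp only [Finset.mem_filter, Finset.mem_sdiff]
  tauto

/-- Greedy colouring: independent sets of the types in the list `ls` are taken out of `U` one
after the other, each restricted to the parts that still have at least `m` vertices. -/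
theorem exists_greedy_coloring {m : ℕ} (ls : Multiset (Fin k → ℕ))
    (hls : ∀ s ∈ ls, ∀ (J : Finset (Fin k)) (U : Finset V), (∀ i ∈ J, m ≤ blockCount β U i) →
      ∃ S ⊆ U, G.IsIndepSet (S : Set V) ∧ ∀ i ∈ J, blockCount β S i = s i) (U : Finset V) :
    ∃ W ⊆ U, (∃ c : V → ℕ, (∀ v ∈ U \ W, c v < ls.card) ∧
        ∀ u ∈ U \ W, ∀ v ∈ U \ W, G.Adj u v → c u ≠ c v) ∧
      ∀ i, blockCount β W i < m ∨
        blockCount β W i + (ls.map fun s => s i).sum ≤ blockCount β U i := by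
  induction ls using Multiset.induction_on generalizing U with
  | empty => exact ⟨U, subset_rfl, ⟨fun _ => 0, by simp, by simp⟩, fun i => Or.inr (by simp)⟩
  | cons s ls ih =>
    obtain ⟨S, hSU, hS, hcount⟩ := hls s (Multiset.mem_cons_self s ls)
      (Finset.univ.filter fun i => m ≤ blockCount β U i) U fun i hi => (Finset.mem_filter.1 hi).2
    obtain ⟨W, hW, ⟨c, hc, hadj⟩, hsize⟩ :=
      ih (fun s' hs' => hls s' (Multiset.mem_cons_of_mem hs')) (U \ S)
    have hmem : ∀ v ∈ U \ W, v ∉ S → v ∈ (U \ S) \ W := fun v hv hvS => by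
      simp only [Finset.mem_sdiff] at hv ⊢
      exact ⟨⟨hv.1, hvS⟩, hv.2⟩
    refine ⟨W, hW.trans Finset.sdiff_subset, ⟨fun v => if v ∈ S then ls.card else c v, ?_, ?_⟩,
      fun i => ?_⟩
    · intro v hv
      rw [Multiset.card_cons]
      dsimp only
      split_ifs with h
      · exact Nat.lt_succ_self _
      · exact (hc v (hmem v hv h)).trans (Nat.lt_succ_self _)
    · intro u hu v hv huv
      dsimp only
      split_ifs with h1 h2 h2
      · exact absurd huv (hS h1 h2 huv.ne)
      · exact (hc v (hmem v hv h2)).ne'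
      · exact (hc u (hmem u hu h1)).ne
      · exact hadj u (hmem u hu h1) v (hmem v hv h2) huv
    · rcases lt_or_ge (blockCount β U i) m with hlt | hge
      · exact Or.inl ((blockCount_mono (hW.trans Finset.sdiff_subset) i).trans_lt hlt)
      · refine (hsize i).imp_right fun h => ?_
        have h1 := hcount i (Finset.mem_filter.2 ⟨Finset.mem_univ _, hge⟩)
        have h2 := blockCount_sdiff_add (β := β) hSU i
        rw [Multiset.map_cons, Multiset.sum_cons]
        omega

theorem chi_le_of_greedy {V : Type} [DecidableEq V] [Fintype V] {β : V → Fin k} {G : SimpleGraph V}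
    {m : ℕ} (ls : Multiset (Fin k → ℕ))
    (hls : ∀ s ∈ ls, ∀ (J : Finset (Fin k)) (U : Finset V), (∀ i ∈ J, m ≤ blockCount β U i) →
      ∃ S ⊆ U, G.IsIndepSet (S : Set V) ∧ ∀ i ∈ J, blockCount β S i = s i)
    (hcover : ∀ i, blockCount β Finset.univ i ≤ (ls.map fun s => s i).sum) :
    chi G ≤ ls.card + k * m := by
  obtain ⟨W, -, ⟨c, hc, hadj⟩, hsize⟩ := exists_greedy_coloring ls hls Finset.univ
  have hW : (W.card : ℝ) ≤ k * m := by
    rw [← sum_blockCount β W]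
    have : ∀ i ∈ (Finset.univ : Finset (Fin k)), (blockCount β W i : ℝ) ≤ m := fun i _ => by
      have h1 := hsize i
      have h2 := hcover i
      exact_mod_cast (show blockCount β W i ≤ m by omega)
    simpa using Finset.sum_le_card_nsmul _ _ _ this
  have hcol : G.Colorable (ls.card + W.card) := by
    have hlt : ∀ v, v ∉ W → c v < ls.card := fun v hv => hc v (by simpa using hv)
    let C : G.Coloring (Fin ls.card ⊕ W) := SimpleGraph.Coloring.mk
      (fun v => if h : v ∈ W then Sum.inr ⟨v, h⟩ else Sum.inl ⟨c v, hlt v h⟩) (by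
        intro u v huv
        by_cases h1 : u ∈ W <;> by_cases h2 : v ∈ W
        · simpa [h1, h2] using huv.ne
        · simp [h1, h2]
        · simp [h1, h2]
        · simpa [h1, h2] using hadj u (by simpa using h1) v (by simpa using h2) huv)
    simpa using C.colorable
  have h1 : G.chromaticNumber.toNat ≤ ls.card + W.card := by
    exact ENat.toNat_le_toNat hcol.chromaticNumber_le (ENat.natCast_ne_top _)
  have h2 : chi G ≤ ls.card + W.card := by
    unfold chi
    exact_mod_cast h1
  linarith

end Greedy

section UpperBound

theorem typeSize_restrict (η : ℝ) (a : Fin k → ℝ) (n : ℕ) (J : Finset (Fin k)) (i : Fin k) :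
    typeSize η (fun i => if i ∈ J then a i else 0) n i = if i ∈ J then typeSize η a n i else 0 := by
  unfold typeSize
  by_cases h : i ∈ J <;> simp [h]

/-- The upper bound for the chromatic number. -/
theorem tendsto_graphProb_lt_chi (hk : 1 ≤ k) (hα : ∀ i, α i ∈ Set.Ioc (0 : ℝ) 1)
    (hα1 : oneNorm α = 1) (hP : P.IsSymm) (hP01 : ∀ i j, P i j ∈ Set.Ioo (0 : ℝ) 1) {ε : ℝ}
    (hε : 0 < ε) :
    Tendsto (fun n : ℕ => graphProb (edgeProb α P hP n) fun G =>
      (1 + ε) * (n / (cStar α P * Real.log n)) < chi G) atTop (𝓝 0) := by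
  classical
  have hc := cStar_pos hα hα1 hP01
  set c := cStar α P
  obtain ⟨ι, _, a, w, ha, -, hw, hw1, hsum⟩ :=
    eq_pos_convex_span_of_mem_convexHull (cStar_smul_mem (α := α) hα1 hP01)
  replace ha : ∀ l, a l ∈ admissible P := fun l => ha ⟨l, rfl⟩
  obtain ⟨η, hη, hη2, hηε⟩ : ∃ η : ℝ, 0 < η ∧ η ≤ 1 / 2 ∧ 4 * η ≤ ε / 2 :=
    ⟨min (1 / 2) (ε / 8), by positivity, min_le_left _ _, by linarith [min_le_right (1 / 2) (ε / 8)]⟩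
  let b : ι → Finset (Fin k) → Fin k → ℝ := fun l J i => if i ∈ J then a l i else 0
  have hb : ∀ l J, b l J ∈ admissible P := fun l J => by
    refine admissible_of_le hP01 (ha l) (fun i => ?_) fun i => ?_ <;> simp only [b] <;> split_ifs
    exacts [(ha l).1 i, le_rfl, le_rfl, (ha l).1 i]
  let good : ∀ n, ι × Finset (Fin k) → SimpleGraph (Vertex α n) → Prop := fun n x G =>
    ∀ U : Finset (Vertex α n),
      (∀ i, typeSize η (b x.1 x.2) n i * cellSize n ≤ blockCount Sigma.fst U i) →
      ∃ S ⊆ U, G.IsIndepSet (S : Set (Vertex α n)) ∧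
        ∀ i, blockCount Sigma.fst S i = typeSize η (b x.1 x.2) n i
  have hlim : Tendsto (fun n : ℕ => ∑ x : ι × Finset (Fin k),
      graphProb (edgeProb α P hP n) fun G => ¬good n x G) atTop (𝓝 0) := by
    have := tendsto_finsetSum (Finset.univ : Finset (ι × Finset (Fin k))) fun x _ =>
      tendsto_graphProb_no_extraction hk hα hα1 hP hP01 (hb x.1 x.2) hη hη2
    rw [Finset.sum_const_zero] at this
    exact this
  refine squeeze_zero' (Eventually.of_forall fun n => graphProb_nonneg
    (blockProb_mem hP hP01 Sigma.fst) _) ?_ hlim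
  have hnat := tendsto_natCast_atTop_atTop (R := ℝ)
  have hinv : Tendsto (fun n : ℕ => (Real.log n)⁻¹) atTop (𝓝 0) :=
    tendsto_inv_atTop_zero.comp tendsto_log_natCast
  have hinvn : Tendsto (fun n : ℕ => (n : ℝ)⁻¹) atTop (𝓝 0) :=
    tendsto_inv_atTop_zero.comp hnat
  have hlogn : Tendsto (fun n : ℕ => Real.log n * (n : ℝ)⁻¹) atTop (𝓝 0) := by
    have := (Real.isLittleO_log_id_atTop.tendsto_div_nhds_zero).comp hnat
    simpa [Function.comp_def, div_eq_mul_inv] using this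
  have hextra : ∀ᶠ n : ℕ in atTop, (Fintype.card ι + k * (n / Real.log n ^ 2 + 1) : ℝ)
      ≤ ε / 2 * (n / (c * Real.log n)) := by
    have h1 : Tendsto (fun n : ℕ => c * ((Fintype.card ι + k) * (Real.log n * (n : ℝ)⁻¹)
        + k * (Real.log n)⁻¹)) atTop (𝓝 (c * ((Fintype.card ι + k) * 0 + k * 0))) :=
      ((hlogn.const_mul _).add (hinv.const_mul _)).const_mul _
    simp only [mul_zero, add_zero] at h1
    filter_upwards [h1.eventually_le_const (half_pos hε), eventually_ge_atTop 2] with n hn hn2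
    have hlog : 0 < Real.log n := Real.log_pos (by exact_mod_cast hn2)
    have hn0 : (0 : ℝ) < n := by positivity
    have := mul_le_mul_of_nonneg_right hn (show (0 : ℝ) ≤ n / (c * Real.log n) by positivity)
    refine le_trans (le_of_eq ?_) this
    field_simp
    ring
  have hcov : ∀ᶠ n : ℕ in atTop, ∀ i,
      α i * n + k ≤ (1 + η) * n * α i - ((1 + 4 * η) * (n / (c * Real.log n)) + Fintype.card ι) := by
    rw [eventually_all]
    intro i
    have h1 : Tendsto (fun n : ℕ => (k + Fintype.card ι) * (n : ℝ)⁻¹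
        + (1 + 4 * η) / c * (Real.log n)⁻¹) atTop (𝓝 ((k + Fintype.card ι) * 0
          + (1 + 4 * η) / c * 0)) :=
      (hinvn.const_mul _).add (hinv.const_mul _)
    simp only [mul_zero, add_zero] at h1
    filter_upwards [h1.eventually_le_const (mul_pos hη (hα i).1), eventually_ge_atTop 2]
      with n hn hn2
    have hlog : 0 < Real.log n := Real.log_pos (by exact_mod_cast hn2)
    have hn0 : (0 : ℝ) < n := by positivity
    have h2 := mul_le_mul_of_nonneg_right hn hn0.le
    have h3 : ((k + Fintype.card ι) * (n : ℝ)⁻¹ + (1 + 4 * η) / c * (Real.log n)⁻¹) * n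
        = k + Fintype.card ι + (1 + 4 * η) * (n / (c * Real.log n)) := by
      field_simp
    rw [h3] at h2
    linarith
  have hlarge : ∀ᶠ n : ℕ in atTop, ∀ l i, a l i ≤ Real.log n := by
    simp only [eventually_all]
    exact fun l i => tendsto_log_natCast.eventually_ge_atTop _
  filter_upwards [hextra, hcov, hlarge, eventually_ge_atTop 2] with n hextra hcov hlarge hn2
  have hlog : 0 < Real.log n := Real.log_pos (by exact_mod_cast hn2)
  have hn0 : (0 : ℝ) < n := by positivity
  have hη1 : 0 < 1 - η := by linarith
  refine le_trans (graphProb_mono (blockProb_mem hP hP01 Sigma.fst) fun G hG => ?_)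
    (graphProb_exists_le (blockProb_mem hP hP01 Sigma.fst) Finset.univ fun x G => ¬good n x G)
  by_contra! hgood
  refine absurd hG (not_lt.2 ?_)
  set m : ℕ := ⌊(n : ℝ) / Real.log n ^ 2⌋₊ + 1 with hm
  set x : ℝ := (1 + η) * n / ((1 - η) * (c * Real.log n)) with hx
  have hx0 : 0 ≤ x := by positivity
  let N : ι → ℕ := fun l => ⌈w l * x⌉₊
  let ls : Multiset (Fin k → ℕ) := ∑ l, N l • ({typeSize η (a l) n} : Multiset (Fin k → ℕ))
  have hcard : ls.card = ∑ l, N l := by simp [ls]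
  have hmapsum : ∀ i, (ls.map fun s => s i).sum = ∑ l, N l * typeSize η (a l) n i := by
    intro i
    let h : Multiset (Fin k → ℕ) →+ ℕ :=
      Multiset.sumAddMonoidHom.comp (Multiset.mapAddMonoidHom fun s : Fin k → ℕ => s i)
    have : (ls.map fun s => s i).sum = h ls := rfl
    rw [this, map_sum]
    refine Finset.sum_congr rfl fun l _ => ?_
    rw [map_nsmul, smul_eq_mul]
    simp [h]
  have hxle : x ≤ (1 + 4 * η) * (n / (c * Real.log n)) := by
    rw [hx, mul_div_assoc', div_le_div_iff₀ (by positivity) (by positivity)]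
    have : (1 + η) ≤ (1 + 4 * η) * (1 - η) := by nlinarith
    have h2 := mul_le_mul_of_nonneg_right this (show (0 : ℝ) ≤ n * (c * Real.log n) by positivity)
    linarith
  have hNle : (∑ l, N l : ℝ) ≤ x + Fintype.card ι := by
    have h1 : ∀ l ∈ (Finset.univ : Finset ι), (N l : ℝ) ≤ w l * x + 1 := fun l _ =>
      (Nat.ceil_lt_add_one (mul_nonneg (hw l).le hx0)).le
    refine (Finset.sum_le_sum h1).trans (le_of_eq ?_)
    rw [Finset.sum_add_distrib, ← Finset.sum_mul, hw1]
    simp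
  have hchi := chi_le_of_greedy (β := (Sigma.fst : Vertex α n → Fin k)) (G := G)
    (m := m) ls (by
      intro s hs J U hU
      obtain ⟨l, -, hl⟩ := Multiset.mem_sum.1 hs
      have hsl : s = typeSize η (a l) n := by
        simpa using Multiset.mem_of_mem_nsmul hl
      obtain ⟨S, hSU, hS, hcount⟩ := hgood (l, J) (Finset.mem_univ _) U (by
        intro i
        simp only [b]
        rw [typeSize_restrict]
        split_ifs with hi
        · refine le_trans ?_ (hU i hi)
          have h1 := typeSize_mul_cellSize_le hη.le (by linarith) (ha l).1 hn2 i
          have h2 : a l i * (n / Real.log n ^ 3) ≤ n / Real.log n ^ 2 := by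
            calc _ ≤ Real.log n * (n / Real.log n ^ 3) := by
                  gcongr
                  exact hlarge l i
              _ = _ := by field_simp
          have h3 := Nat.lt_floor_add_one ((n : ℝ) / Real.log n ^ 2)
          have h4 : ((typeSize η (a l) n i * cellSize n : ℕ) : ℝ) ≤ (m : ℕ) := by
            rw [hm]
            push_cast
            linarith
          exact_mod_cast h4
        · simp)
      refine ⟨S, hSU, hS, fun i hi => ?_⟩
      rw [hcount i, hsl]
      simp only [b]
      rw [typeSize_restrict, if_pos hi]) (by
      intro i
      rw [blockCount_univ, hmapsum]
      have h1 := blockSize_le hk hα hα1 n i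
      have h2 : ∑ l, (N l : ℝ) * ((1 - η) * Real.log n * a l i - 1)
          ≤ ∑ l, (N l : ℝ) * typeSize η (a l) n i := Finset.sum_le_sum fun l _ =>
        mul_le_mul_of_nonneg_left (Nat.sub_one_lt_floor _).le (Nat.cast_nonneg _)
      have h3 : (1 + η) * n * α i ≤ ∑ l, (N l : ℝ) * ((1 - η) * Real.log n * a l i) := by
        calc (1 + η) * n * α i = ∑ l, w l * x * ((1 - η) * Real.log n * a l i) := by
              have : ∑ l, w l * a l i = c * α i := by
                simpa using congrFun hsum i
              have e : (1 + η) * n * α i = x * ((1 - η) * Real.log n) * (c * α i) := by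
                rw [hx]
                field_simp
              rw [e, ← this, Finset.mul_sum]
              exact Finset.sum_congr rfl fun l _ => by ring
          _ ≤ _ := Finset.sum_le_sum fun l _ => mul_le_mul_of_nonneg_right (Nat.le_ceil _)
              (mul_nonneg (mul_nonneg hη1.le hlog.le) ((ha l).1 i))
      have h4 : ∑ l, (N l : ℝ) * ((1 - η) * Real.log n * a l i - 1)
          = ∑ l, (N l : ℝ) * ((1 - η) * Real.log n * a l i) - ∑ l, (N l : ℝ) := by
        rw [← Finset.sum_sub_distrib]
        exact Finset.sum_congr rfl fun l _ => by ring
      have h5 := hcov i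
      have h6 : (blockSize α n i : ℝ) ≤ ((∑ l, N l * typeSize η (a l) n i : ℕ) : ℝ) := by
        push_cast
        linarith
      exact_mod_cast h6)
  rw [hcard] at hchi
  push_cast at hchi
  have hmle : (m : ℝ) ≤ n / Real.log n ^ 2 + 1 := by
    rw [hm]
    push_cast
    exact add_le_add_left (Nat.floor_le (by positivity)) 1
  have hkm : (k * m : ℝ) ≤ k * (n / Real.log n ^ 2 + 1) := by gcongr
  have hfin : (4 * η) * (n / (c * Real.log n)) ≤ ε / 2 * (n / (c * Real.log n)) := by gcongr
  linarith

end UpperBound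

end RandomBlockGraph

theorem theorem1 (k : ℕ) (hk : 1 ≤ k) (α : Fin k → ℝ) (hα : ∀ i, α i ∈ Set.Ioc (0 : ℝ) 1)
    (hα1 : RandomBlockGraph.oneNorm α = 1) (P : Matrix (Fin k) (Fin k) ℝ) (hP : P.IsSymm)
    (hP01 : ∀ i j, P i j ∈ Set.Ioo (0 : ℝ) 1) :
    IsGreatest (RandomBlockGraph.rayNorms α P) (RandomBlockGraph.cStar α P) ∧
    0 < RandomBlockGraph.cStar α P ∧
    ∀ ε : ℝ, 0 < ε →
      Tendsto (fun n : ℕ => RandomBlockGraph.law α P hP n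
          {G | |RandomBlockGraph.chi G - n / (RandomBlockGraph.cStar α P * Real.log n)|
            ≤ ε * (n / (RandomBlockGraph.cStar α P * Real.log n))})
        atTop (𝓝 1) := by
  refine ⟨RandomBlockGraph.isGreatest_cStar hα1 hP01, RandomBlockGraph.cStar_pos hα hα1 hP01,
    fun ε hε => RandomBlockGraph.tendsto_law_one hP hP01 _ ?_⟩
  have hp := fun n => RandomBlockGraph.blockProb_mem hP hP01
    (Sigma.fst : RandomBlockGraph.Vertex α n → Fin k)
  have hlim := (RandomBlockGraph.tendsto_graphProb_chi_lt hk hα hα1 hP hP01 hε).add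
    (RandomBlockGraph.tendsto_graphProb_lt_chi hk hα hα1 hP hP01 hε)
  rw [add_zero] at hlim
  refine squeeze_zero (fun n => RandomBlockGraph.graphProb_nonneg (hp n) _) (fun n => ?_) hlim
  have h := RandomBlockGraph.graphProb_exists_le (hp n) (Finset.univ : Finset Bool) fun b G =>
    if b then RandomBlockGraph.chi G < (1 - ε) * (n / (RandomBlockGraph.cStar α P * Real.log n))
    else (1 + ε) * (n / (RandomBlockGraph.cStar α P * Real.log n)) < RandomBlockGraph.chi G
  simp only [Fintype.sum_bool, if_true, Bool.false_eq_true, if_false] at h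
  refine le_trans (RandomBlockGraph.graphProb_mono (hp n) fun G hG => ?_) h
  rw [abs_le, not_and_or, not_le, not_le] at hG
  rcases hG with hG | hG
  · exact ⟨true, Finset.mem_univ _, by simp only [if_true]; linarith⟩
  · exact ⟨false, Finset.mem_univ _, by simp only [Bool.false_eq_true, if_false]; linarith⟩
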